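/- **Setting.** Let $m\ge1$, $d\ge 0$, and let $f_i:\mathbb R^d\to\mathbb R$ ($i\in[m]$) be convex and differentiable with locally Lipschitz gradient, $r_i:\mathbb R^d\to(-\infty,+\infty]$ convex, proper and lower semicontinuous, and $\sum_i f_i+\sum_i r_i$ bounded below. Write $F(\mathbf X)=\sum_i f_i(x_i)$, $R(\mathbf X)=\sum_i r_i(x_i)$ for $\mathbf X=[x_1,\dots,x_m]^\top\in\mathbb R^{m\times d}$; all norms and inner products of matrices are Frobenius. Let $\mathcal G$ be a connected undirected graph on $[m]$, and let $\widetilde W$ be symmetric and doubly stochastic with $\widetilde w_{ii}>0$, $\widetilde w_{ij}>0$ for edges $(i,j)$, and $\widetilde w_{ij}=0$ for all other $i\ne j$. Put $W=(1-c)I+c\widetilde W$ with $c\in(0,1/2)$. Let $\text{Ł}$ be a symmetric matrix with $\text{Ł}^2=I-W$, and $M=\sqrt{I-\text{Ł}^2}\succ0$. For $\mathscr X=(\mathbf X,\widetilde{\mathbf X})$ and $\mathscr S=(\mathbf S,\widetilde{\mathbf S})$ in $\mathbb R^{2m\times d}$ let $$\mathcal L(\mathscr X,\mathscr S)=F(\mathbf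 X)+\delta_{\{0\}}(\text{Ł}\mathbf X+M\widetilde{\mathbf X})+\langle\mathscr S,\mathscr X\rangle-\widetilde R^*(\mathscr S),\qquad \widetilde R(\mathscr X)=R(\mathbf X)+\delta_{\{0\}}(\widetilde{\mathbf X}),$$ where $\widetilde R^*$ is the Fenchel conjugate (and $\mathcal L=-\infty$ where $\widetilde R^*=+\infty$). Let $\mathcal P^*\times\mathcal D^*$ be the set of saddle points of $\mathcal L$ (minimization in $\mathscr X$, maximization in $\mathscr S$), and assume that it is nonempty. **Algorithm.** Fix $\eta,\delta\in(0,1)$, a summable sequence $m^k\ge0$, initial stepsizes $\alpha_i^{-1}>0$, arbitrary $\mathbf X^0,\mathbf S^0\in\mathbb R^{m\times d}$, and $\mathbf A^0=\mathbf D^0=0$. For $k=0,1,2,\dots$: 1. $\mathbf X^{k+1/2}=W\mathbf X^k$ and $\mathbf D^{k+1/2}=W(\nabla F(\mathbf X^k)+\mathbf S^k+\mathbf D^k)$. 2. Each agent $i$ lets $\beta_i^k$ be the first $\beta$ among $\widetilde\alpha,\eta\widetilde\alpha,\eta^2\widetilde\alpha,\dots$, with $\widetilde\alpha=\sqrt{(\alpha_i^{k-1})^2+m^k}$,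 such that $f_i(x^+)\le f_i(x_i^k)+\langle\nabla f_i(x_i^k),x^+-x_i^k\rangle+\frac{\delta}{2\beta}\|x^+-x_i^k\|^2$, where $x^+=x_i^{k+1/2}-\beta\, d_i^{k+1/2}$. 3. $\alpha_i^k$ is the minimum of $\beta_j^k$ over $j=i$ and all neighbours $j$ of $i$; $\Lambda^k=\mathrm{diag}(\alpha_1^k,\dots,\alpha_m^k)$. 4. $\mathbf A^{k+1}=\mathbf X^{k+1/2}-\Lambda^k\mathbf D^{k+1/2}$; $\ x_i^{k+1}=\mathrm{prox}_{\alpha_i^k r_i}(a_i^{k+1}+\alpha_i^k s_i^k)$ for all $i$; $\ \mathbf S^{k+1}=\mathbf S^k+(\Lambda^k)^{-1}(\mathbf A^{k+1}-\mathbf X^{k+1})$; $\ \mathbf D^{k+1}=\mathbf D^{k+1/2}+(I-W)(\Lambda^k)^{-1}\mathbf X^k-\nabla F(\mathbf X^k)-\mathbf S^k$. Put $\alpha_{\min}^k=\min_i\alpha_i^k$ for $k\ge-1$. The lifted iterates are $\mathscr X^k=(\mathbf X^k,0)$; $\mathscr S^k=(\mathbf S^k,-M\mathbf Y^k)$, where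 $\mathbf Y^0=0$ and $\mathbf Y^{k+1}=\mathbf Y^k+\text{Ł}\big((\Lambda^k)^{-1}\mathbf X^k-\mathbf S^k-\mathbf D^k-\nabla F(\mathbf X^k)\big)$, so that $\mathbf D^k=\text{Ł}\mathbf Y^k$; and $\mathscr A^k=(\mathbf A^k,\widetilde{\mathbf A}^k)$, where $\widetilde{\mathbf A}^k$ is determined by $\text{Ł}\mathbf A^k+M\widetilde{\mathbf A}^k=0$. **Theorem.** Suppose that, for some $\underline\alpha>0$, $\alpha_{\min}^k\ge\underline\alpha$ for all $k\ge0$. Then $(\mathscr X^k,\mathscr S^k)$ converges to some point of $\mathcal P^*\times\mathcal D^*$. Moreover, for every $(\mathscr X^*,\mathscr S^*)\in\mathcal P^*\times\mathcal D^*$ there exist compact sets $\mathcal B_X,\mathcal B_S\subset\mathbb R^{2m\times d}$ and $K'\ge1$ such that $\Lambda^k=\alpha_{\min}^kI$ for all $k\ge K'$, and (i) $(\mathscr X^*,\mathscr S^*)\in\mathcal B_X\times\mathcal B_S$, and $(\mathscr A^k,\mathscr S^k)\in\mathrm{int}(\mathcal B_X\times\mathcal B_S)$ for all $k\ge K'$;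 (ii) with the partial gap $\mathcal G(\mathscr X,\mathscr S)=\sup_{\mathscr S'\in\mathcal B_S}\mathcal L(\mathscr X,\mathscr S')-\inf_{\mathscr X'\in\mathcal B_X}\mathcal L(\mathscr X',\mathscr S)$, the constant $C_{K'}=2\sum_{t=1}^{K'}\alpha_{\min}^{t-1}\,\mathcal G(\mathscr A^t,\mathscr S^t)$ is finite, and for all $k>K'$ and every $\widetilde L^k>0$ such that $\nabla F$ is $\widetilde L^k$-Lipschitz on $\mathrm{conv}\big(\bigcup_{t=0}^{k-1}[\mathbf X^t,\mathbf A^{t+1}]\big)$, $$\mathcal G(\overline{\mathscr A}^k,\overline{\mathscr S}^k)\le\frac1{k-K'}\cdot\frac{C_{K'}+\Big(1+\alpha_{\min}^{K'-1}\sqrt{\tfrac{20}{\underline\alpha^2}+3}\Big)^2\mathcal V^{K'}}{2\min\big(\alpha_{\min}^{-1},\ \delta/(2\widetilde L^k)\big)},$$ where $\alpha_{\min}^{-1}$ is the smallest initial stepsize, $\mathcal V^{K'}=\|\mathscr X^{K'}-\mathscr X^*\|^2+(\alpha_{\min}^{K'-1})^2\|\mathscr S^{K'}-\mathscr S^*\|^2$,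 and $\overline{\mathscr A}^k=\frac1{\theta^k}\sum_{t=K'}^k\alpha_{\min}^{t-1}\mathscr A^t$, $\overline{\mathscr S}^k=\frac1{\theta^k}\sum_{t=K'}^k\alpha_{\min}^{t-1}\mathscr S^t$, $\theta^k=\sum_{t=K'}^k\alpha_{\min}^{t-1}$. -/

import Mathlib

open Filter Topology
open scoped NNReal

noncomputable section

/-- `m × d` real matrices viewed as stacks of `m` rows in `ℝ^d`, with the Frobenius inner product. -/
abbrev Stack (m d : ℕ) : Type := PiLp 2 (fun _ : Fin m => EuclideanSpace ℝ (Fin d))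

/-- `2m × d` real matrices, as pairs of `m × d` blocks, with the Frobenius inner product. -/
abbrev Lifted (m d : ℕ) : Type := WithLp 2 (Stack m d × Stack m d)

/-- The `2m × d` matrix with upper block `X` and lower block `Y`. -/
def block {m d : ℕ} (X Y : Stack m d) : Lifted m d := WithLp.toLp 2 (X, Y)

/-- The matrix product of an `m × m` matrix with an `m × d` matrix. -/
def rowMix {m d : ℕ} (W : Matrix (Fin m) (Fin m) ℝ) (X : Stack m d) : Stack m d :=
  WithLp.toLp 2 (fun i => ∑ j, W i j • X j)

/-- The product of the diagonal matrix `diag a` with an `m × d` matrix. -/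
def rowScale {m d : ℕ} (a : Fin m → ℝ) (X : Stack m d) : Stack m d :=
  WithLp.toLp 2 (fun i => a i • X i)

/-! ### Convex analysis for extended-real-valued functions -/

/-- Convex, proper and lower semicontinuous extended-real-valued functions. -/
structure IsConvexProperLsc {E : Type*} [TopologicalSpace E] [AddCommMonoid E] [Module ℝ E]
    (g : E → EReal) : Prop where
  convex_epigraph : Convex ℝ {p : E × ℝ | g p.1 ≤ (p.2 : EReal)}
  ne_bot : ∀ x, g x ≠ ⊥
  exists_ne_top : ∃ x, g x ≠ ⊤
  lsc : LowerSemicontinuous g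

/-- The indicator function of the set `{0}`: `0` at the origin, `+∞` elsewhere. -/
def indicatorZero {E : Type*} [Zero E] (x : E) : EReal :=
  open Classical in if x = 0 then 0 else ⊤

/-- The Fenchel conjugate. -/
def fenchel {E : Type*} [NormedAddCommGroup E] [InnerProductSpace ℝ E] (g : E → EReal) (s : E) :
    EReal :=
  ⨆ x : E, ((inner ℝ s x : ℝ) : EReal) - g x

/-- `p = prox_{α g}(x)`, i.e. `p` minimizes `y ↦ g y + ‖x - y‖² / (2 α)`. -/
def IsProx {E : Type*} [NormedAddCommGroup E] (α : ℝ) (g : E → EReal) (x p : E) : Prop :=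
  ∀ y : E, g p + ((1 / (2 * α) * ‖x - p‖ ^ 2 : ℝ) : EReal) ≤
    g y + ((1 / (2 * α) * ‖x - y‖ ^ 2 : ℝ) : EReal)

/-- `(x, s)` is a saddle point of `L` (minimization in the first, maximization in the second
argument). -/
def IsSaddle {E : Type*} (L : E → E → EReal) (x s : E) : Prop :=
  (∀ s', L x s' ≤ L x s) ∧ ∀ x', L x s ≤ L x' s

/-- The partial primal-dual gap of `L` relative to `BX × BS`. -/
def partialGap {E : Type*} (L : E → E → EReal) (BX BS : Set E) (x s : E) : EReal :=
  (⨆ s' ∈ BS, L x s') - ⨅ x' ∈ BX, L x' s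

/-! ### The problem -/

/-- The assumptions on the losses: every `f i` is real-valued, convex, and locally smooth
(differentiable with locally Lipschitz gradient), every `r i` is convex, proper and lower
semicontinuous, and `∑ f i + ∑ r i` is bounded below. -/
structure ObjectiveAssumptions {m d : ℕ} (f : Fin m → EuclideanSpace ℝ (Fin d) → ℝ)
    (r : Fin m → EuclideanSpace ℝ (Fin d) → EReal) : Prop where
  f_convex : ∀ i, ConvexOn ℝ Set.univ (f i)
  f_differentiable : ∀ i, Differentiable ℝ (f i)
  f_locally_smooth : ∀ i, LocallyLipschitz (gradient (f i))
  r_convex_proper_lsc : ∀ i, IsConvexProperLsc (r i)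
  bounded_below : ∃ b : ℝ, ∀ x, (b : EReal) ≤ ((∑ i, f i x : ℝ) : EReal) + ∑ i, r i x

/-- Symmetric doubly stochastic gossip matrices compliant with the graph `G`. -/
structure IsGossip {m : ℕ} (G : SimpleGraph (Fin m)) (W : Matrix (Fin m) (Fin m) ℝ) : Prop where
  symm : W.IsSymm
  row_sum : ∀ i, ∑ j, W i j = 1
  diag_pos : ∀ i, 0 < W i i
  edge_pos : ∀ i j, G.Adj i j → 0 < W i j
  off_edge : ∀ i j, i ≠ j → ¬ G.Adj i j → W i j = 0

/-- `Lc` is a symmetric matrix with `Lc² = I - W` and `Mc = √(I - Lc²)` is the positive definite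
square root of `I - Lc²`. -/
structure IsBCVPair {m : ℕ} (W Lc Mc : Matrix (Fin m) (Fin m) ℝ) : Prop where
  symm : Lc.IsSymm
  sq_eq : Lc * Lc = 1 - W
  posDef : Mc.PosDef
  metric_sq_eq : Mc * Mc = 1 - Lc * Lc

/-- `F(X) = ∑ f_i(x_i)`. -/
def sumLoss {m d : ℕ} (f : Fin m → EuclideanSpace ℝ (Fin d) → ℝ) (X : Stack m d) : ℝ :=
  ∑ i, f i (X i)

/-- `∇F(X)`, whose `i`-th row is `∇f_i(x_i)`. -/
def gradLoss {m d : ℕ} (f : Fin m → EuclideanSpace ℝ (Fin d) → ℝ) (X : Stack m d) : Stack m d :=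
  WithLp.toLp 2 (fun i => gradient (f i) (X i))

/-- The lifted regularizer `(X, X̃) ↦ ∑ r_i(x_i) + δ_{0}(X̃)`. -/
def liftedReg {m d : ℕ} (r : Fin m → EuclideanSpace ℝ (Fin d) → EReal) (x : Lifted m d) : EReal :=
  (∑ i, r i (x.fst i)) + indicatorZero x.snd

/-- The lifted consensus constraint `(X, X̃) ↦ δ_{0}(Lc X + Mc X̃)`. -/
def liftedCons {m d : ℕ} (Lc Mc : Matrix (Fin m) (Fin m) ℝ) (x : Lifted m d) : EReal :=
  indicatorZero (rowMix Lc x.fst + rowMix Mc x.snd)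

/-- The Lagrangian. In `EReal` a sum with a summand `-∞` is `-∞`, so the value is `-∞` wherever the
conjugate is `+∞`, and otherwise `+∞` where the constraint fails. -/
def lagrangian {m d : ℕ} (f : Fin m → EuclideanSpace ℝ (Fin d) → ℝ)
    (r : Fin m → EuclideanSpace ℝ (Fin d) → EReal) (Lc Mc : Matrix (Fin m) (Fin m) ℝ)
    (x s : Lifted m d) : EReal :=
  (sumLoss f x.fst : EReal) + liftedCons Lc Mc x + ((inner ℝ s x : ℝ) : EReal)
    - fenchel (liftedReg r) s

/-! ### The algorithm -/

/-- The acceptance test of the line search at the trial stepsize `a`. -/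
def LinesearchAccepts {d : ℕ} (g : EuclideanSpace ℝ (Fin d) → ℝ) (x₁ x₂ v : EuclideanSpace ℝ (Fin d))
    (δ a : ℝ) : Prop :=
  g (x₂ + a • v) ≤ g x₁ + inner ℝ (gradient g x₁) (x₂ + a • v - x₁)
    + δ / (2 * a) * ‖x₂ + a • v - x₁‖ ^ 2

/-- `b` is the output of the backtracking line search started at the stepsize `a`: the first of
`a, η a, η² a, …` that is accepted. -/
def IsLinesearch {d : ℕ} (g : EuclideanSpace ℝ (Fin d) → ℝ) (a : ℝ)
    (x₁ x₂ v : EuclideanSpace ℝ (Fin d)) (η δ b : ℝ) : Prop :=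
  ∃ t : ℕ, b = η ^ t * a ∧ LinesearchAccepts g x₁ x₂ v δ b ∧
    ∀ s < t, ¬ LinesearchAccepts g x₁ x₂ v δ (η ^ s * a)

/-- The half step `D^{k+1/2} = W (∇F(X) + S + D)`. -/
def halfD {m d : ℕ} (f : Fin m → EuclideanSpace ℝ (Fin d) → ℝ) (W : Matrix (Fin m) (Fin m) ℝ)
    (X S D : Stack m d) : Stack m d :=
  rowMix W (gradLoss f X + S + D)

/-- `(α, X, A, S, D)` are the iterates of decentralized adaptive three operator splitting with local
min-consensus. Stepsizes are indexed with a shift by one: `α 0` collects the initial stepsizes, with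
index `-1`, and `α (k + 1)` the stepsizes `(α_i^k)_i` used in iteration `k`. -/
structure IsLocalDATOS {m d : ℕ} (G : SimpleGraph (Fin m)) (W : Matrix (Fin m) (Fin m) ℝ)
    (f : Fin m → EuclideanSpace ℝ (Fin d) → ℝ) (r : Fin m → EuclideanSpace ℝ (Fin d) → EReal)
    (η δ : ℝ) (slack : ℕ → ℝ) (α : ℕ → Fin m → ℝ) (X A S D : ℕ → Stack m d) : Prop where
  init_step : ∀ i, 0 < α 0 i
  init_A : A 0 = 0
  init_D : D 0 = 0
  /-- Line search of every agent, giving stepsizes `β`, followed by the minimum of `β` over the agent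
  itself and its neighbours. -/
  step : ∀ k, ∃ β : Fin m → ℝ,
    (∀ i, IsLinesearch (f i) (Real.sqrt ((α k i) ^ 2 + slack k)) (X k i) (rowMix W (X k) i)
      (-(halfD f W (X k) (S k) (D k) i)) η δ (β i)) ∧
    ∀ i, IsLeast (β '' {j | j = i ∨ G.Adj i j}) (α (k + 1) i)
  update_A : ∀ k, A (k + 1) =
    rowMix W (X k) - rowScale (α (k + 1)) (halfD f W (X k) (S k) (D k))
  update_X : ∀ k i, IsProx (α (k + 1) i) (r i) (A (k + 1) i + α (k + 1) i • S k i) (X (k + 1) i)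
  update_S : ∀ k, S (k + 1) =
    S k + rowScale (fun i => (α (k + 1) i)⁻¹) (A (k + 1) - X (k + 1))
  update_D : ∀ k, D (k + 1) = halfD f W (X k) (S k) (D k)
    + rowMix (1 - W) (rowScale (fun i => (α (k + 1) i)⁻¹) (X k)) - gradLoss f (X k) - S k

/-- The smallest of the agents' stepsizes. -/
def minStep {m : ℕ} (a : Fin m → ℝ) : ℝ := ⨅ i, a i

/-- The variable `Y` behind `D`, which satisfies `D = Lc Y`:
`Y⁰ = 0` and `Y^{k+1} = Y^k + Lc ((Λ^k)⁻¹ X^k - S^k - D^k - ∇F(X^k))`. -/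
def dualY {m d : ℕ} (f : Fin m → EuclideanSpace ℝ (Fin d) → ℝ) (Lc : Matrix (Fin m) (Fin m) ℝ)
    (α : ℕ → Fin m → ℝ) (X S D : ℕ → Stack m d) : ℕ → Stack m d
  | 0 => 0
  | k + 1 => dualY f Lc α X S D k + rowMix Lc
      (rowScale (fun i => (α (k + 1) i)⁻¹) (X k) - S k - D k - gradLoss f (X k))

/-- The lifted primal iterates `(X^k, 0)`. -/
def liftedX {m d : ℕ} (X : ℕ → Stack m d) (k : ℕ) : Lifted m d := block (X k) 0

/-- The lifted dual iterates `(S^k, -Mc Y^k)`. -/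
def liftedS {m d : ℕ} (f : Fin m → EuclideanSpace ℝ (Fin d) → ℝ)
    (Lc Mc : Matrix (Fin m) (Fin m) ℝ) (α : ℕ → Fin m → ℝ) (X S D : ℕ → Stack m d) (k : ℕ) :
    Lifted m d :=
  block (S k) (-rowMix Mc (dualY f Lc α X S D k))

/-- The lifted intermediate iterates `(A^k, Ã^k)`, where `Ã^k` is the unique matrix with
`Lc A^k + Mc Ã^k = 0`. Whenever `A^k` was computed with equal stepsizes `α^{k-1}`, this is also the
lower block `α^{k-1} (S̃^k - S̃^{k-1})` of the proximal step on the lifted constraint. -/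
def liftedA {m d : ℕ} (Lc Mc : Matrix (Fin m) (Fin m) ℝ) (A : ℕ → Stack m d) (k : ℕ) :
    Lifted m d :=
  block (A k) (-rowMix (Mc⁻¹ * Lc) (A k))

/-- The merit function `‖X^k - X*‖² + (α_min^{k-1})² ‖S^k - S*‖²` in the lifted variables. -/
def merit {m d : ℕ} (α : ℕ → Fin m → ℝ) (x s : ℕ → Lifted m d) (xs ss : Lifted m d) (k : ℕ) : ℝ :=
  ‖x k - xs‖ ^ 2 + (minStep (α k)) ^ 2 * ‖s k - ss‖ ^ 2

/-- The average of `z^K, …, z^k` in which `z^t` has a weight proportional to `α_min^{t-1}`. -/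
def ergodic {m d : ℕ} (α : ℕ → Fin m → ℝ) (K : ℕ) (z : ℕ → Lifted m d) (k : ℕ) : Lifted m d :=
  (∑ t ∈ Finset.Icc K k, minStep (α t))⁻¹ • ∑ t ∈ Finset.Icc K k, minStep (α t) • z t

/-- The convex hull of the segments `[X^t, A^{t+1}]`, `t < k`. -/
def trajectoryHull {m d : ℕ} (X A : ℕ → Stack m d) (k : ℕ) : Set (Stack m d) :=
  convexHull ℝ (⋃ t ∈ Finset.range k, segment ℝ (X t) (A (t + 1)))

end

/-! On its effective domain `V × Q` (the consensus subspace times the domain of the conjugate) the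
Lagrangian is `Φ x + ⟨s, x⟩ - ρ s` with `Φ`, `ρ` convex. With a common stepsize `τ`, the lifted
iteration is a three operator splitting: `a` is the projection of `x - τ ∇Φ x - τ s` onto `V`, the
next `x` is a proximal point of the regularizer at `a + τ s`, and `s` moves by `(a - x) / τ`.
Convexity, the line search and the projection yield the energy inequality `splitting_energy`.

The stepsizes become common after finitely many iterations (`eventually_consensus`). Each
backtracking shrinks a stepsize by a factor of at most `η`, while the slack is summable and the
stepsizes stay away from zero. So backtracking eventually stops, and the neighbourhood minima then
spread the smallest stepsize through the connected graph. From there on the common stepsize is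
nondecreasing and bounded (`IsLocalDATOS.exists_tail`).

Divided by the squared stepsize, the energy inequality makes `‖x - u‖² / σ² + ‖s - p‖²`
nonincreasing for every saddle point `(u, p)`. The residuals vanish, cluster points are saddle
points, and a Fejér argument gives convergence (`IsSplittingTail.exists_tendsto_saddle`).

For the rate, take closed balls containing all iterates and the given saddle point. Since the
iterates converge, the summed energy over `(j, k]` is arbitrarily small for late `j`, uniformly on
these balls (`IsSplittingTail.sum_energy_le`). The freedom to choose `K'` then decides
(`exists_start_index`): if some early partial gap is positive, `K'` is taken so late that its
contribution to `C` dominates the tail; if all vanish, Jensen's inequality gives a nonpositive gap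
for the averages. Hence `C` alone, divided by `2 (k - K')` times the smallest initial stepsize, is
already a bound. -/

/-! ### Primal-dual splitting with nondecreasing stepsizes -/

/-- The value `Φ x + ⟨s, x⟩ - ρ s` of a bilinear saddle function on its effective domain. -/
noncomputable def saddleValue {H : Type*} [NormedAddCommGroup H] [InnerProductSpace ℝ H]
    (Φ ρ : H → ℝ) (x s : H) : ℝ :=
  Φ x + inner ℝ s x - ρ s

/-- From index `N` on, `(x, a, s)` are iterates of a primal-dual splitting scheme with nondecreasing
bounded stepsizes `σ` that satisfy the basic energy inequality on `V × Q`. -/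
structure IsSplittingTail {H : Type*} [NormedAddCommGroup H] [InnerProductSpace ℝ H]
    (Φ ρ : H → ℝ) (V Q : Set H) (δ : ℝ) (N : ℕ) (σ : ℕ → ℝ) (x a s : ℕ → H) : Prop where
  pos : ∀ k, N ≤ k → 0 < σ k
  mono : ∀ k, N ≤ k → σ k ≤ σ (k + 1)
  bdd : ∃ T, ∀ k, N ≤ k → σ k ≤ T
  mem_primal : ∀ k, N ≤ k → a (k + 1) ∈ V
  mem_dual : ∀ k, N ≤ k → s (k + 1) ∈ Q
  dual_update : ∀ k, N ≤ k → a (k + 1) - x (k + 1) = σ (k + 1) • (s (k + 1) - s k)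
  monotone : ∀ k, N ≤ k → 0 ≤ inner ℝ (s (k + 1) - s k) (x (k + 1) - x k)
  energy : ∀ k, N ≤ k → ∀ u ∈ V, ∀ p ∈ Q,
    2 * σ (k + 1) * (saddleValue Φ ρ (a (k + 1)) p - saddleValue Φ ρ u (s (k + 1))) ≤
      ‖x k - u‖ ^ 2 - ‖x (k + 1) - u‖ ^ 2
        + σ (k + 1) ^ 2 * (‖s k - p‖ ^ 2 - ‖s (k + 1) - p‖ ^ 2)
        - (1 - δ) * ‖x k - a (k + 1)‖ ^ 2

section

variable {H : Type*} [NormedAddCommGroup H] [InnerProductSpace ℝ H]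

/-- Pure algebra after eliminating `x'`. The two inner products with `a - u` are what the projection
condition turns into a gradient term. -/
theorem energy_identity {τ : ℝ} {x a x' s s' u p : H} (h : a - x' = τ • (s' - s)) :
    2 * τ * (inner ℝ p a - inner ℝ s' u - inner ℝ x' (p - s'))
        + 2 * inner ℝ (x - a) (a - u) - 2 * τ * inner ℝ s (a - u) =
      ‖x - u‖ ^ 2 - ‖x' - u‖ ^ 2 + τ ^ 2 * (‖s - p‖ ^ 2 - ‖s' - p‖ ^ 2) - ‖x - a‖ ^ 2 := by
  obtain rfl : x' = a - τ • (s' - s) := by rw [← h]; abel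
  simp only [← real_inner_self_eq_norm_sq, inner_sub_left, inner_sub_right, real_inner_smul_left,
    real_inner_smul_right]
  rw [real_inner_comm p a, real_inner_comm s' a, real_inner_comm s a, real_inner_comm s s',
    real_inner_comm s p, real_inner_comm s' p, real_inner_comm u s, real_inner_comm u s',
    real_inner_comm a x, real_inner_comm u a, real_inner_comm u x]
  ring

/-- The energy inequality of one iteration. -/
theorem splitting_energy {Φ ρ : H → ℝ} {τ δ : ℝ} (hτ : 0 < τ) {x a x' s s' u p g : H}
    (hdescent : Φ a ≤ Φ x + inner ℝ g (a - x) + δ / (2 * τ) * ‖a - x‖ ^ 2)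
    (hconv : Φ x + inner ℝ g (u - x) ≤ Φ u)
    (hproj : inner ℝ (x - τ • g - τ • s - a) (a - u) = 0)
    (hsub : ρ s' + inner ℝ x' (p - s') ≤ ρ p)
    (hdual : a - x' = τ • (s' - s)) :
    2 * τ * (saddleValue Φ ρ a p - saddleValue Φ ρ u s') ≤
      ‖x - u‖ ^ 2 - ‖x' - u‖ ^ 2 + τ ^ 2 * (‖s - p‖ ^ 2 - ‖s' - p‖ ^ 2)
        - (1 - δ) * ‖x - a‖ ^ 2 := by
  have key := energy_identity (x := x) (u := u) (p := p) hdual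
  have hg : τ * inner ℝ g (a - u) = inner ℝ (x - a) (a - u) - τ * inner ℝ s (a - u) := by
    have e : x - τ • g - τ • s - a = (x - a) - τ • g - τ • s := by abel
    rw [e, inner_sub_left, inner_sub_left, real_inner_smul_left, real_inner_smul_left] at hproj
    linarith
  have hgs : inner ℝ g (a - u) = inner ℝ g (a - x) - inner ℝ g (u - x) := by
    rw [← inner_sub_right]; congr 1; abel
  have hval : saddleValue Φ ρ a p - saddleValue Φ ρ u s' ≤
      inner ℝ g (a - u) + δ / (2 * τ) * ‖x - a‖ ^ 2
        + (inner ℝ p a - inner ℝ s' u - inner ℝ x' (p - s')) := by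
    unfold saddleValue
    rw [norm_sub_rev x a]
    linarith
  have h2 := mul_le_mul_of_nonneg_left hval (by positivity : 0 ≤ 2 * τ)
  -- The line search error consumes the fraction `δ` of `‖x - a‖²`; the fraction `1 - δ` survives
  -- and later forces the residuals to vanish.
  have e : 2 * τ * (δ / (2 * τ) * ‖x - a‖ ^ 2) = δ * ‖x - a‖ ^ 2 := by field_simp
  nlinarith

end

namespace IsSplittingTail

variable {H : Type*} [NormedAddCommGroup H] [InnerProductSpace ℝ H]
  {Φ ρ : H → ℝ} {V Q : Set H} {δ : ℝ} {N : ℕ} {σ : ℕ → ℝ} {x a s : ℕ → H}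

theorem shift (h : IsSplittingTail Φ ρ V Q δ N σ x a s) :
    IsSplittingTail Φ ρ V Q δ 0 (fun k => σ (N + k)) (fun k => x (N + k)) (fun k => a (N + k))
      (fun k => s (N + k)) where
  pos k _ := h.pos _ (Nat.le_add_right N k)
  mono k _ := h.mono _ (Nat.le_add_right N k)
  bdd := h.bdd.imp fun _ hT k _ => hT _ (Nat.le_add_right N k)
  mem_primal k _ := h.mem_primal _ (Nat.le_add_right N k)
  mem_dual k _ := h.mem_dual _ (Nat.le_add_right N k)
  dual_update k _ := h.dual_update _ (Nat.le_add_right N k)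
  monotone k _ := h.monotone _ (Nat.le_add_right N k)
  energy k _ := h.energy _ (Nat.le_add_right N k)

theorem monotoneOn (h : IsSplittingTail Φ ρ V Q δ N σ x a s) {j k : ℕ} (hj : N ≤ j)
    (hjk : j ≤ k) : σ j ≤ σ k := by
  induction k, hjk using Nat.le_induction with
  | base => exact le_rfl
  | succ n hn ih => exact ih.trans (h.mono n (hj.trans hn))

theorem tendsto_step (h : IsSplittingTail Φ ρ V Q δ 0 σ x a s) :
    ∃ l, 0 < l ∧ Tendsto σ atTop (𝓝 l) := by
  have hm : Monotone σ := monotone_nat_of_le_succ fun k => h.mono k (Nat.zero_le k)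
  obtain ⟨T, hT⟩ := h.bdd
  have hb : BddAbove (Set.range σ) := ⟨T, by rintro _ ⟨k, rfl⟩; exact hT k (Nat.zero_le k)⟩
  exact ⟨_, (h.pos 0 le_rfl).trans_le (le_ciSup hb 0), tendsto_atTop_ciSup hm hb⟩

/-- In the expansion of `‖a (k + 1) - x k‖²` along the dual update, the cross term is nonnegative by
monotonicity. Vanishing residuals therefore make both increments vanish. -/
theorem increments_le (h : IsSplittingTail Φ ρ V Q δ N σ x a s) {k : ℕ} (hk : N ≤ k) :
    σ (k + 1) ^ 2 * ‖s (k + 1) - s k‖ ^ 2 + ‖x (k + 1) - x k‖ ^ 2 ≤ ‖x k - a (k + 1)‖ ^ 2 := by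
  have e : a (k + 1) - x k = σ (k + 1) • (s (k + 1) - s k) + (x (k + 1) - x k) := by
    rw [← h.dual_update k hk]; abel
  have hp := h.pos (k + 1) (hk.trans (Nat.le_succ k))
  rw [norm_sub_rev (x k), e, norm_add_sq_real, norm_smul, real_inner_smul_left, mul_pow,
    Real.norm_eq_abs, sq_abs]
  have := mul_nonneg hp.le (h.monotone k hk)
  linarith

/-- The scaled distance to a saddle point decreases. -/
theorem scaled_energy (h : IsSplittingTail Φ ρ V Q δ N σ x a s) {u p : H} (hu : u ∈ V)
    (hp : p ∈ Q) (hs : ∀ u' ∈ V, ∀ p' ∈ Q, saddleValue Φ ρ u p' ≤ saddleValue Φ ρ u' p) {k : ℕ}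
    (hk : N ≤ k) :
    ‖x (k + 1) - u‖ ^ 2 / σ (k + 1) ^ 2 + ‖s (k + 1) - p‖ ^ 2
        + (1 - δ) * ‖x k - a (k + 1)‖ ^ 2 / σ (k + 1) ^ 2 ≤
      ‖x k - u‖ ^ 2 / σ k ^ 2 + ‖s k - p‖ ^ 2 := by
  have hσ := h.pos k hk
  have hσ' := h.pos (k + 1) (hk.trans (Nat.le_succ k))
  have hgap := hs _ (h.mem_primal k hk) _ (h.mem_dual k hk)
  have hE := h.energy k hk u hu p hp
  have h0 : 0 ≤ 2 * σ (k + 1) * (saddleValue Φ ρ (a (k + 1)) p - saddleValue Φ ρ u (s (k + 1))) :=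
    mul_nonneg (by positivity) (by linarith)
  -- The only place where growing stepsizes matter: a larger denominator can only lower the primal
  -- term.
  have h1 : ‖x k - u‖ ^ 2 / σ (k + 1) ^ 2 ≤ ‖x k - u‖ ^ 2 / σ k ^ 2 := by
    have := h.mono k hk
    gcongr
  refine le_trans ?_ (add_le_add_left h1 _)
  have h2 : 0 < σ (k + 1) ^ 2 := by positivity
  rw [← sub_nonneg]
  have e : ‖x k - u‖ ^ 2 / σ (k + 1) ^ 2 + ‖s k - p‖ ^ 2 -
      (‖x (k + 1) - u‖ ^ 2 / σ (k + 1) ^ 2 + ‖s (k + 1) - p‖ ^ 2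
        + (1 - δ) * ‖x k - a (k + 1)‖ ^ 2 / σ (k + 1) ^ 2) =
      (‖x k - u‖ ^ 2 - ‖x (k + 1) - u‖ ^ 2
        + σ (k + 1) ^ 2 * (‖s k - p‖ ^ 2 - ‖s (k + 1) - p‖ ^ 2)
        - (1 - δ) * ‖x k - a (k + 1)‖ ^ 2) / σ (k + 1) ^ 2 := by
    field_simp
    ring
  rw [e]
  exact div_nonneg (by linarith) h2.le

theorem tendsto_zero_of_sq {E : Type*} [NormedAddCommGroup E] {v : ℕ → E} {w : ℕ → ℝ}
    (hw : Tendsto w atTop (𝓝 0)) (h : ∀ k, ‖v k‖ ^ 2 ≤ w k) : Tendsto v atTop (𝓝 0) := by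
  have h1 : Tendsto (fun k => ‖v k‖ ^ 2) atTop (𝓝 0) :=
    squeeze_zero (fun _ => by positivity) h hw
  rw [tendsto_zero_iff_norm_tendsto_zero]
  simpa using h1.sqrt

/-- Convergence of the iterates to a saddle point. -/
theorem exists_tendsto_saddle [FiniteDimensional ℝ H]
    (h : IsSplittingTail Φ ρ V Q δ N σ x a s) (hδ : δ < 1) (hΦ : Continuous Φ) (hV : IsClosed V)
    (hlsc : ∀ (p : ℕ → H) (c : ℕ → ℝ) (q : H) (b : ℝ), (∀ k, p k ∈ Q) → (∀ k, ρ (p k) ≤ c k) →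
      Tendsto p atTop (𝓝 q) → Tendsto c atTop (𝓝 b) → q ∈ Q ∧ ρ q ≤ b)
    (hsaddle : ∃ u ∈ V, ∃ p ∈ Q, ∀ u' ∈ V, ∀ p' ∈ Q, saddleValue Φ ρ u p' ≤ saddleValue Φ ρ u' p) :
    ∃ u ∈ V, ∃ p ∈ Q, (∀ u' ∈ V, ∀ p' ∈ Q, saddleValue Φ ρ u p' ≤ saddleValue Φ ρ u' p) ∧
      Tendsto x atTop (𝓝 u) ∧ Tendsto a atTop (𝓝 u) ∧ Tendsto s atTop (𝓝 p) := by
  suffices H0 : ∀ (σ : ℕ → ℝ) (x a s : ℕ → H), IsSplittingTail Φ ρ V Q δ 0 σ x a s →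
      ∃ u ∈ V, ∃ p ∈ Q, (∀ u' ∈ V, ∀ p' ∈ Q, saddleValue Φ ρ u p' ≤ saddleValue Φ ρ u' p) ∧
        Tendsto x atTop (𝓝 u) ∧ Tendsto a atTop (𝓝 u) ∧ Tendsto s atTop (𝓝 p) by
    obtain ⟨u, hu, p, hp, hs, hx, ha, hsl⟩ := H0 _ _ _ _ h.shift
    simp only [add_comm N] at hx ha hsl
    exact ⟨u, hu, p, hp, hs, (tendsto_add_atTop_iff_nat N).1 hx, (tendsto_add_atTop_iff_nat N).1 ha,
      (tendsto_add_atTop_iff_nat N).1 hsl⟩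
  clear h
  intro σ x a s h
  obtain ⟨l, hl, hσl⟩ := h.tendsto_step
  obtain ⟨T, hT⟩ := h.bdd
  replace hT : ∀ k, σ k ≤ T := fun k => hT k (Nat.zero_le k)
  have hσ : ∀ k, 0 < σ k := fun k => h.pos k (Nat.zero_le k)
  have hTp : 0 < T := (hσ 0).trans_le (hT 0)
  have hanti : ∀ u ∈ V, ∀ p ∈ Q,
      (∀ u' ∈ V, ∀ p' ∈ Q, saddleValue Φ ρ u p' ≤ saddleValue Φ ρ u' p) →
      Antitone fun k => ‖x k - u‖ ^ 2 / σ k ^ 2 + ‖s k - p‖ ^ 2 := by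
    intro u hu p hp hs
    refine antitone_nat_of_succ_le fun k => ?_
    have h1 := h.scaled_energy hu hp hs (Nat.zero_le k)
    have h2 : 0 ≤ (1 - δ) * ‖x k - a (k + 1)‖ ^ 2 / σ (k + 1) ^ 2 :=
      div_nonneg (mul_nonneg (by linarith) (by positivity)) (by positivity)
    linarith
  -- The upper bound `T` on the stepsizes turns control of the scaled distance back into control of
  -- `x`.
  have hxle : ∀ (u p : H) (k : ℕ),
      ‖x k - u‖ ^ 2 ≤ T ^ 2 * (‖x k - u‖ ^ 2 / σ k ^ 2 + ‖s k - p‖ ^ 2) := by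
    intro u p k
    have h1 : ‖x k - u‖ ^ 2 = σ k ^ 2 * (‖x k - u‖ ^ 2 / σ k ^ 2) := by
      have := (hσ k).ne'
      field_simp
    have h2 : σ k ^ 2 ≤ T ^ 2 := by
      have := hσ k
      have := hT k
      gcongr
    calc ‖x k - u‖ ^ 2 = σ k ^ 2 * (‖x k - u‖ ^ 2 / σ k ^ 2) := h1
      _ ≤ T ^ 2 * (‖x k - u‖ ^ 2 / σ k ^ 2) := by gcongr
      _ ≤ _ := by gcongr; nlinarith [sq_nonneg ‖s k - p‖]
  obtain ⟨u₀, hu₀, p₀, hp₀, hs₀⟩ := hsaddle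
  have hA₀ := hanti u₀ hu₀ p₀ hp₀ hs₀
  -- residuals vanish
  have hres : Tendsto (fun k => x k - a (k + 1)) atTop (𝓝 0) := by
    set U : ℕ → ℝ := fun k => ‖x k - u₀‖ ^ 2 / σ k ^ 2 + ‖s k - p₀‖ ^ 2 with hU
    have hUb : BddBelow (Set.range U) := ⟨0, by rintro _ ⟨k, rfl⟩; positivity⟩
    have hUl := tendsto_atTop_ciInf hA₀ hUb
    have hd : Tendsto (fun k => T ^ 2 / (1 - δ) * (U k - U (k + 1))) atTop (𝓝 0) := by
      have := (hUl.sub (hUl.comp (tendsto_add_atTop_nat 1))).const_mul (T ^ 2 / (1 - δ))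
      simpa using this
    refine tendsto_zero_of_sq hd fun k => ?_
    have h1 := h.scaled_energy hu₀ hp₀ hs₀ (Nat.zero_le k)
    have h2 : (1 - δ) * ‖x k - a (k + 1)‖ ^ 2 / σ (k + 1) ^ 2 ≤ U k - U (k + 1) := by
      simp only [hU]; linarith
    have h3 : σ (k + 1) ^ 2 ≤ T ^ 2 := by
      have := hσ (k + 1)
      have := hT (k + 1)
      gcongr
    have hδ' : 0 < 1 - δ := by linarith
    have h4 : (1 - δ) * ‖x k - a (k + 1)‖ ^ 2 ≤ T ^ 2 * (U k - U (k + 1)) := by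
      rw [div_le_iff₀ (by have := hσ (k + 1); positivity)] at h2
      have h5 : 0 ≤ U k - U (k + 1) := sub_nonneg.2 (hA₀ (Nat.le_succ k))
      nlinarith
    rw [div_mul_eq_mul_div, le_div_iff₀ hδ']
    linarith
  have hdx : Tendsto (fun k => x (k + 1) - x k) atTop (𝓝 0) := by
    have := (hres.norm.pow 2)
    simp only [norm_zero, ne_eq, OfNat.ofNat_ne_zero, not_false_eq_true, zero_pow] at this
    refine tendsto_zero_of_sq this fun k => ?_
    have := h.increments_le (Nat.zero_le k)
    nlinarith [mul_nonneg (sq_nonneg (σ (k + 1))) (sq_nonneg ‖s (k + 1) - s k‖)]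
  have hds : Tendsto (fun k => s (k + 1) - s k) atTop (𝓝 0) := by
    have := (hres.norm.pow 2).const_mul (1 / σ 0 ^ 2)
    simp only [norm_zero, ne_eq, OfNat.ofNat_ne_zero, not_false_eq_true, zero_pow, mul_zero] at this
    refine tendsto_zero_of_sq this fun k => ?_
    have h1 := h.increments_le (Nat.zero_le k)
    have h2 : σ 0 ^ 2 ≤ σ (k + 1) ^ 2 := by
      have := hσ 0
      have := h.monotoneOn le_rfl (Nat.zero_le (k + 1))
      gcongr
    rw [div_mul_eq_mul_div, one_mul, le_div_iff₀ (by have := hσ 0; positivity)]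
    nlinarith [sq_nonneg ‖x (k + 1) - x k‖, sq_nonneg ‖s (k + 1) - s k‖]
  -- a cluster point
  obtain ⟨⟨u, p⟩, -, φ, hφ, hlim⟩ : ∃ z ∈ closure (Metric.closedBall u₀
      (T * Real.sqrt (‖x 0 - u₀‖ ^ 2 / σ 0 ^ 2 + ‖s 0 - p₀‖ ^ 2)) ×ˢ Metric.closedBall p₀
      (Real.sqrt (‖x 0 - u₀‖ ^ 2 / σ 0 ^ 2 + ‖s 0 - p₀‖ ^ 2))), ∃ φ : ℕ → ℕ, StrictMono φ ∧
      Tendsto ((fun k => (x k, s k)) ∘ φ) atTop (𝓝 z) := by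
    refine tendsto_subseq_of_bounded
      (Metric.isBounded_closedBall.prod Metric.isBounded_closedBall) fun k => ?_
    have h1 : ‖x k - u₀‖ ^ 2 / σ k ^ 2 + ‖s k - p₀‖ ^ 2 ≤
      ‖x 0 - u₀‖ ^ 2 / σ 0 ^ 2 + ‖s 0 - p₀‖ ^ 2 := hA₀ (Nat.zero_le k)
    refine ⟨?_, ?_⟩
    · simp only [Metric.mem_closedBall, dist_eq_norm]
      refine abs_le_of_sq_le_sq' ?_ (by positivity) |>.2
      rw [mul_pow, Real.sq_sqrt (by positivity)]
      exact (hxle u₀ p₀ k).trans (by gcongr)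
    · simp only [Metric.mem_closedBall, dist_eq_norm]
      refine Real.le_sqrt_of_sq_le (le_trans ?_ h1)
      have : 0 ≤ ‖x k - u₀‖ ^ 2 / σ k ^ 2 := by positivity
      linarith
  have hφt := hφ.tendsto_atTop
  have hx : Tendsto (fun k => x (φ k)) atTop (𝓝 u) := (continuous_fst.tendsto _).comp hlim
  have hs : Tendsto (fun k => s (φ k)) atTop (𝓝 p) := (continuous_snd.tendsto _).comp hlim
  have hx' : Tendsto (fun k => x (φ k + 1)) atTop (𝓝 u) := by
    simpa using hx.add (hdx.comp hφt)
  have hs' : Tendsto (fun k => s (φ k + 1)) atTop (𝓝 p) := by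
    simpa using hs.add (hds.comp hφt)
  have ha' : Tendsto (fun k => a (φ k + 1)) atTop (𝓝 u) := by
    simpa using hx.sub (hres.comp hφt)
  have hσφ : Tendsto (fun k => σ (φ k + 1)) atTop (𝓝 l) :=
    hσl.comp ((tendsto_add_atTop_nat 1).comp hφt)
  have hu : u ∈ V := hV.mem_of_tendsto ha' (Eventually.of_forall fun k => h.mem_primal _ (by simp))
  -- Solved for `ρ (s (φ k + 1))`, the energy inequality bounds it by a convergent sequence, as
  -- consecutive iterates share their limit. Lower semicontinuity then gives membership in `Q` and
  -- the saddle inequality together.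
  have hlimit : ∀ u' ∈ V, ∀ p' ∈ Q, p ∈ Q ∧
      ρ p ≤ Φ u' + inner ℝ p u' - saddleValue Φ ρ u p' := by
    intro u' hu' p' hp'
    refine hlsc (fun k => s (φ k + 1)) (fun k => Φ u' + inner ℝ (s (φ k + 1)) u'
        - saddleValue Φ ρ (a (φ k + 1)) p' + (2 * σ (φ k + 1))⁻¹ *
        (‖x (φ k) - u'‖ ^ 2 - ‖x (φ k + 1) - u'‖ ^ 2
        + σ (φ k + 1) ^ 2 * (‖s (φ k) - p'‖ ^ 2 - ‖s (φ k + 1) - p'‖ ^ 2))) _ _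
      (fun k => h.mem_dual _ (by simp)) (fun k => ?_) hs' ?_
    · have h1 := h.energy (φ k) (by simp) u' hu' p' hp'
      have h2 : 0 ≤ (1 - δ) * ‖x (φ k) - a (φ k + 1)‖ ^ 2 :=
        mul_nonneg (by linarith) (by positivity)
      have h3 := hσ (φ k + 1)
      have h4 : saddleValue Φ ρ (a (φ k + 1)) p' - saddleValue Φ ρ u' (s (φ k + 1)) ≤
          (2 * σ (φ k + 1))⁻¹ * (‖x (φ k) - u'‖ ^ 2 - ‖x (φ k + 1) - u'‖ ^ 2
          + σ (φ k + 1) ^ 2 * (‖s (φ k) - p'‖ ^ 2 - ‖s (φ k + 1) - p'‖ ^ 2)) := by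
        rw [inv_mul_eq_div, le_div_iff₀ (by positivity)]
        linarith
      have h5 : saddleValue Φ ρ u' (s (φ k + 1)) =
        Φ u' + inner ℝ (s (φ k + 1)) u' - ρ (s (φ k + 1)) := rfl
      linarith
    · have hin : Tendsto (fun k => inner ℝ (s (φ k + 1)) u') atTop (𝓝 (inner ℝ p u')) :=
        hs'.inner tendsto_const_nhds
      have hsv : Tendsto (fun k => saddleValue Φ ρ (a (φ k + 1)) p') atTop
          (𝓝 (saddleValue Φ ρ u p')) :=
        (((hΦ.tendsto u).comp ha').add (tendsto_const_nhds.inner ha')).sub_const _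
      have hr : Tendsto (fun k => (2 * σ (φ k + 1))⁻¹ *
          (‖x (φ k) - u'‖ ^ 2 - ‖x (φ k + 1) - u'‖ ^ 2
          + σ (φ k + 1) ^ 2 * (‖s (φ k) - p'‖ ^ 2 - ‖s (φ k + 1) - p'‖ ^ 2))) atTop
          (𝓝 ((2 * l)⁻¹ * (‖u - u'‖ ^ 2 - ‖u - u'‖ ^ 2
            + l ^ 2 * (‖p - p'‖ ^ 2 - ‖p - p'‖ ^ 2)))) :=
        ((hσφ.const_mul 2).inv₀ (by positivity)).mul
          ((((hx.sub_const u').norm.pow 2).sub ((hx'.sub_const u').norm.pow 2)).add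
            ((hσφ.pow 2).mul
              (((hs.sub_const p').norm.pow 2).sub ((hs'.sub_const p').norm.pow 2))))
      have := ((tendsto_const_nhds (x := Φ u')).add hin).sub hsv |>.add hr
      simpa using this
  have hp : p ∈ Q := (hlimit u hu p₀ hp₀).1
  have hup : ∀ u' ∈ V, ∀ p' ∈ Q, saddleValue Φ ρ u p' ≤ saddleValue Φ ρ u' p := by
    intro u' hu' p' hp'
    have := (hlimit u' hu' p' hp').2
    have e : saddleValue Φ ρ u' p = Φ u' + inner ℝ p u' - ρ p := rfl
    linarith
  -- Fejér argument: the scaled distance to this particular saddle point is monotone and tends to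
  -- zero along a subsequence, hence along the whole sequence.
  have hA := hanti u hu p hp hup
  have hA0 : Tendsto (fun k => ‖x k - u‖ ^ 2 / σ k ^ 2 + ‖s k - p‖ ^ 2) atTop (𝓝 0) := by
    have h1 := tendsto_atTop_ciInf hA ⟨0, by rintro _ ⟨k, rfl⟩; positivity⟩
    have h2 : Tendsto (fun k => ‖x (φ k) - u‖ ^ 2 / σ (φ k) ^ 2 + ‖s (φ k) - p‖ ^ 2) atTop
        (𝓝 0) := by
      have := (((hx.sub_const u).norm.pow 2).div ((hσl.comp hφt).pow 2) (by positivity)).add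
        ((hs.sub_const p).norm.pow 2)
      simpa using this
    rwa [tendsto_nhds_unique (h1.comp hφt) h2] at h1
  have hxu : Tendsto x atTop (𝓝 u) := by
    have h1 := hA0.const_mul (T ^ 2)
    rw [mul_zero] at h1
    have := tendsto_zero_of_sq h1 (hxle u p)
    simpa using this.add_const u
  have hsp : Tendsto s atTop (𝓝 p) := by
    have := tendsto_zero_of_sq (v := fun k => s k - p) hA0 fun k => by
      have : 0 ≤ ‖x k - u‖ ^ 2 / σ k ^ 2 := by positivity
      linarith
    simpa using this.add_const p
  refine ⟨u, hu, p, hp, hup, hxu, ?_, hsp⟩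
  rw [← tendsto_add_atTop_iff_nat 1]
  simpa using hxu.sub hres

/-- Summed energy inequality; the increase of the stepsizes is paid by the diameter. -/
theorem sum_energy (h : IsSplittingTail Φ ρ V Q δ N σ x a s) (hδ : δ < 1) {u p : H} (hu : u ∈ V)
    (hp : p ∈ Q) {B : ℝ} {j k : ℕ} (hj : N ≤ j) (hB : ∀ t, j ≤ t → ‖s t - p‖ ^ 2 ≤ B)
    (hjk : j + 1 ≤ k) :
    ∑ t ∈ Finset.Icc (j + 1) k,
        2 * σ t * (saddleValue Φ ρ (a t) p - saddleValue Φ ρ u (s t)) ≤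
      ‖x j - u‖ ^ 2 - ‖x k - u‖ ^ 2 + σ (j + 1) ^ 2 * ‖s j - p‖ ^ 2 - σ k ^ 2 * ‖s k - p‖ ^ 2
        + (σ k ^ 2 - σ (j + 1) ^ 2) * B := by
  have hdrop : ∀ t, 0 ≤ (1 - δ) * ‖x t - a (t + 1)‖ ^ 2 := fun t =>
    mul_nonneg (by linarith) (by positivity)
  induction k, hjk using Nat.le_induction with
  | base =>
    simp only [Finset.Icc_self, Finset.sum_singleton]
    linarith [h.energy j hj u hu p hp, hdrop j]
  | succ n hn ih =>
    rw [Finset.sum_Icc_succ_top (by omega)]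
    have hNn : N ≤ n := by omega
    have h1 := h.energy n hNn u hu p hp
    have h2 : σ n ^ 2 ≤ σ (n + 1) ^ 2 := by
      have := h.pos n hNn
      have := h.mono n hNn
      gcongr
    nlinarith [hdrop n, hB n (by omega)]

theorem sq_norm_sub_sub_le {H : Type*} [NormedAddCommGroup H] {v w z : H} {b : ℝ}
    (hv : ‖v - z‖ ≤ b) (hw : ‖w - z‖ ≤ b) :
    ‖v - z‖ ^ 2 - ‖w - z‖ ^ 2 ≤ 2 * b * ‖v - w‖ := by
  have h1 : ‖v - z‖ - ‖w - z‖ ≤ ‖v - w‖ := by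
    have := norm_sub_norm_le (v - z) (w - z)
    simpa using this
  have h2 := norm_nonneg (v - z)
  have h3 := norm_nonneg (w - z)
  have h4 := norm_nonneg (v - w)
  nlinarith

/-- For convergent iterates the weighted gap sums are eventually small, uniformly on bounded sets. -/
theorem sum_energy_le (h : IsSplittingTail Φ ρ V Q δ N σ x a s) (hδ : δ < 1) {u₀ p₀ : H}
    (hx : Tendsto x atTop (𝓝 u₀)) (hs : Tendsto s atTop (𝓝 p₀)) (R : ℝ) {ε : ℝ} (hε : 0 < ε) :
    ∃ J, N ≤ J ∧ ∀ j, J ≤ j → ∀ k, j + 1 ≤ k → ∀ u ∈ V, ∀ p ∈ Q, ‖u‖ ≤ R → ‖p‖ ≤ R →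
      ∑ t ∈ Finset.Icc (j + 1) k,
        2 * σ t * (saddleValue Φ ρ (a t) p - saddleValue Φ ρ u (s t)) ≤ ε := by
  obtain ⟨T, hT⟩ := h.bdd
  have hTp : 0 < T := (h.pos N le_rfl).trans_le (hT N le_rfl)
  obtain ⟨bx, hbx⟩ := hx.norm.bddAbove_range
  obtain ⟨bs, hbs⟩ := hs.norm.bddAbove_range
  replace hbx : ∀ k, ‖x k‖ ≤ bx := fun k => hbx ⟨k, rfl⟩
  replace hbs : ∀ k, ‖s k‖ ≤ bs := fun k => hbs ⟨k, rfl⟩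
  -- A bound for all distances from iterates to points of the ball of radius `R`; the lower bound
  -- `1` keeps the denominator of `ε'` positive.
  set b := max (max bx bs + |R|) 1 with hb
  have hb1 : 1 ≤ b := le_max_right _ _
  have hxb : ∀ k u, ‖u‖ ≤ R → ‖x k - u‖ ≤ b := fun k u hu =>
    (norm_sub_le _ _).trans <| le_trans (add_le_add ((hbx k).trans (le_max_left _ _))
      (hu.trans (le_abs_self R))) (le_max_left _ _)
  have hsb : ∀ k p, ‖p‖ ≤ R → ‖s k - p‖ ≤ b := fun k p hp =>
    (norm_sub_le _ _).trans <| le_trans (add_le_add ((hbs k).trans (le_max_right _ _))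
      (hp.trans (le_abs_self R))) (le_max_left _ _)
  -- the squared stepsizes are Cauchy
  have hσc : CauchySeq fun k => σ (N + k) ^ 2 := by
    obtain ⟨l, -, hl⟩ := h.shift.tendsto_step
    exact (hl.pow 2).cauchySeq
  -- The three summands match the primal difference, the dual difference and the growth of the
  -- squared stepsize.
  set ε' := ε / (3 * (2 * b + T ^ 2 * (2 * b) + b ^ 2)) with hε'
  have hden : 0 < 3 * (2 * b + T ^ 2 * (2 * b) + b ^ 2) := by positivity
  have hε'p : 0 < ε' := div_pos hε hden
  obtain ⟨J₁, hJ₁⟩ := Metric.cauchySeq_iff.1 hx.cauchySeq ε' hε'p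
  obtain ⟨J₂, hJ₂⟩ := Metric.cauchySeq_iff.1 hs.cauchySeq ε' hε'p
  obtain ⟨J₃, hJ₃⟩ := Metric.cauchySeq_iff.1 hσc ε' hε'p
  refine ⟨max N (max (max J₁ J₂) (N + J₃)), le_max_left _ _, fun j hj k hk u hu p hp huR hpR => ?_⟩
  simp only [max_le_iff] at hj
  obtain ⟨hNj, ⟨hj₁, hj₂⟩, hj₃⟩ := hj
  have h0 := h.sum_energy hδ hu hp (B := b ^ 2) hNj
    (fun t _ => by have := hsb t p hpR; gcongr) hk
  have hxd : ‖x j - x k‖ ≤ ε' := by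
    have := hJ₁ j hj₁ k (by omega)
    rw [dist_eq_norm] at this
    exact this.le
  have hsd : ‖s j - s k‖ ≤ ε' := by
    have := hJ₂ j hj₂ k (by omega)
    rw [dist_eq_norm] at this
    exact this.le
  have hσd : σ k ^ 2 - σ (j + 1) ^ 2 ≤ ε' := by
    have := hJ₃ (k - N) (by omega) (j + 1 - N) (by omega)
    rw [Real.dist_eq, Nat.add_sub_cancel' (by omega), Nat.add_sub_cancel' (by omega)] at this
    exact (le_abs_self _).trans this.le
  have h1 := sq_norm_sub_sub_le (hxb j u huR) (hxb k u huR)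
  have h2 := sq_norm_sub_sub_le (hsb j p hpR) (hsb k p hpR)
  have hσ1 : 0 < σ (j + 1) := h.pos _ (by omega)
  have hσk : σ (j + 1) ≤ σ k := h.monotoneOn (by omega) hk
  have hσT : σ (j + 1) ^ 2 ≤ T ^ 2 := by
    have := hT (j + 1) (by omega)
    gcongr
  have hσ2 : σ (j + 1) ^ 2 ≤ σ k ^ 2 := by gcongr
  have h3 : σ (j + 1) ^ 2 * ‖s j - p‖ ^ 2 - σ k ^ 2 * ‖s k - p‖ ^ 2 ≤ T ^ 2 * (2 * b * ε') := by
    calc σ (j + 1) ^ 2 * ‖s j - p‖ ^ 2 - σ k ^ 2 * ‖s k - p‖ ^ 2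
        ≤ σ (j + 1) ^ 2 * (‖s j - p‖ ^ 2 - ‖s k - p‖ ^ 2) := by
          nlinarith [sq_nonneg ‖s k - p‖]
      _ ≤ σ (j + 1) ^ 2 * (2 * b * ε') := by
          gcongr
          exact h2.trans (by gcongr)
      _ ≤ _ := by gcongr
  have h4 : ‖x j - u‖ ^ 2 - ‖x k - u‖ ^ 2 ≤ 2 * b * ε' := h1.trans (by gcongr)
  have h5 : (σ k ^ 2 - σ (j + 1) ^ 2) * b ^ 2 ≤ ε' * b ^ 2 := by gcongr
  have h6 : ε' * (3 * (2 * b + T ^ 2 * (2 * b) + b ^ 2)) = ε := div_mul_cancel₀ _ hden.ne'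
  have h7 : 0 ≤ ε' * (2 * b + T ^ 2 * (2 * b) + b ^ 2) := by positivity
  linarith

end IsSplittingTail

/-! ### Local min-consensus of backtracked stepsizes -/

section MinConsensus

variable {ι : Type*} [Fintype ι]

/-- Subtracting the partial sums of `e` leaves an antitone sequence that is bounded below. -/
theorem exists_tendsto_of_le_add {u e : ℕ → ℝ} {b : ℝ} (hu : ∀ k, b ≤ u k) (he : ∀ k, 0 ≤ e k)
    (hsum : Summable e) (h : ∀ k, u (k + 1) ≤ u k + e k) : ∃ l, b ≤ l ∧ Tendsto u atTop (𝓝 l) := by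
  set v : ℕ → ℝ := fun k => u k - ∑ t ∈ Finset.range k, e t with hv
  have hanti : Antitone v := antitone_nat_of_succ_le fun k => by
    simp only [hv, Finset.sum_range_succ]
    linarith [h k]
  have hb : BddBelow (Set.range v) := ⟨b - ∑' t, e t, by
    rintro _ ⟨k, rfl⟩
    have := hsum.sum_le_tsum (Finset.range k) fun i _ => he i
    simp only [hv]
    linarith [hu k]⟩
  have hlim := (tendsto_atTop_ciInf hanti hb).add hsum.hasSum.tendsto_sum_nat
  simp only [hv, sub_add_cancel] at hlim
  exact ⟨_, ge_of_tendsto' hlim hu, hlim⟩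

/-- Backtracking stepsizes that are bounded away from zero are eventually never reduced. -/
theorem eventually_sq_eq_of_backtracking {η b : ℝ} (hη : η ∈ Set.Ioo (0 : ℝ) 1) (hb : 0 < b)
    {slack u β : ℕ → ℝ} (hs : ∀ k, 0 ≤ slack k) (hsum : Summable slack) (hu : ∀ k, b ≤ u k)
    (hβ : ∀ k, ∃ t : ℕ, β k = η ^ t * Real.sqrt (u k ^ 2 + slack k)) (huβ : ∀ k, u (k + 1) ≤ β k) :
    ∀ᶠ k in atTop, β k = Real.sqrt (u k ^ 2 + slack k) := by
  have hpos : ∀ k, 0 < u k := fun k => hb.trans_le (hu k)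
  have hle : ∀ k, u (k + 1) ^ 2 ≤ u k ^ 2 + slack k := fun k => by
    obtain ⟨t, ht⟩ := hβ k
    have h1 : u (k + 1) ≤ Real.sqrt (u k ^ 2 + slack k) := by
      refine (huβ k).trans (ht ▸ mul_le_of_le_one_left (Real.sqrt_nonneg _) ?_)
      exact pow_le_one₀ hη.1.le hη.2.le
    have h2 := pow_le_pow_left₀ (hpos (k + 1)).le h1 2
    rwa [Real.sq_sqrt (add_nonneg (sq_nonneg _) (hs k))] at h2
  obtain ⟨l, hl, hlim⟩ := exists_tendsto_of_le_add (u := fun k => u k ^ 2) (b := b ^ 2)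
    (fun k => by have := hu k; gcongr) hs hsum hle
  have hlp : 0 < l := lt_of_lt_of_le (by positivity) hl
  -- One reduction would put `u (k + 1) ^ 2` below a sequence with limit `η ^ 2 * l < l`, although
  -- it tends to `l` itself.
  have h3 : Tendsto (fun k => η ^ 2 * (u k ^ 2 + slack k)) atTop (𝓝 (η ^ 2 * (l + 0))) :=
    (hlim.add hsum.tendsto_atTop_zero).const_mul _
  have h4 : η ^ 2 * (l + 0) < l := by
    rw [add_zero]
    exact mul_lt_of_lt_one_left hlp (pow_lt_one₀ hη.1.le hη.2 two_ne_zero)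
  filter_upwards [h3.eventually_lt (hlim.comp (tendsto_add_atTop_nat 1)) h4] with k hk
  obtain ⟨t, ht⟩ := hβ k
  rcases Nat.eq_zero_or_pos t with rfl | htp
  · simpa using ht
  · exfalso
    have h5 : u (k + 1) ≤ η * Real.sqrt (u k ^ 2 + slack k) := by
      refine (huβ k).trans (ht ▸ mul_le_mul_of_nonneg_right ?_ (Real.sqrt_nonneg _))
      exact pow_le_of_le_one hη.1.le hη.2.le htp.ne'
    have h6 := pow_le_pow_left₀ (hpos (k + 1)).le h5 2
    rw [mul_pow, Real.sq_sqrt (add_nonneg (sq_nonneg _) (hs k))] at h6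
    simp only [Function.comp] at hk
    linarith

/-- Repeated minima over closed neighbourhoods of a connected graph reach the global minimum. -/
theorem eventually_eq_of_min_neighbors [Nonempty ι] {G : SimpleGraph ι} (hG : G.Connected)
    {v : ℕ → ι → ℝ} (hle : ∀ k i j, (j = i ∨ G.Adj i j) → v (k + 1) i ≤ v k j)
    (hex : ∀ k i, ∃ j, v k j ≤ v (k + 1) i) :
    ∃ N, ∀ k, N ≤ k → ∀ i j, v k i = v k j := by
  obtain ⟨j₀, hj₀⟩ := Finite.exists_min (v 0)
  have hlow : ∀ k i, v 0 j₀ ≤ v k i := by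
    intro k
    induction k with
    | zero => exact hj₀
    | succ k ih => exact fun i => (hex k i).elim fun j hj => (ih j).trans hj
  -- A value travels one edge per iteration, so a walk of length at most `k` has carried the initial
  -- value at `j` to `i`.
  have hup : ∀ {i j : ι} (p : G.Walk i j) (k : ℕ), p.length ≤ k → v k i ≤ v 0 j := by
    intro i j p
    induction p with
    | nil =>
      intro k _
      exact antitone_nat_of_succ_le (f := fun k => v k _) (fun k => hle k _ _ (Or.inl rfl))
        (Nat.zero_le k)
    | cons hadj q ih =>
      intro k hk
      obtain ⟨k, rfl⟩ : ∃ k', k = k' + 1 := ⟨k - 1, by simp at hk; omega⟩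
      exact (hle k _ _ (Or.inr hadj)).trans (ih k (by simpa using hk))
  have p : ∀ i, G.Walk i j₀ := fun i => (hG.preconnected i j₀).some
  refine ⟨Finset.univ.sup fun i => (p i).length, fun k hk i j => ?_⟩
  have hval : ∀ i, v k i = v 0 j₀ := fun i => le_antisymm
    (hup (p i) k ((Finset.le_sup (f := fun i => (p i).length) (Finset.mem_univ i)).trans hk))
    (hlow k i)
  rw [hval i, hval j]

/-- Stepsizes that are backtracked locally and minimized over neighbourhoods become equal, and the
line search then accepts the first trial. -/
theorem eventually_consensus [Nonempty ι] {G : SimpleGraph ι} (hG : G.Connected) {η b : ℝ}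
    (hη : η ∈ Set.Ioo (0 : ℝ) 1) (hb : 0 < b) {slack : ℕ → ℝ} (hs : ∀ k, 0 ≤ slack k)
    (hsum : Summable slack) {α : ℕ → ι → ℝ} (hα : ∀ k i, b ≤ α k i) {Acc : ℕ → ι → ℝ → Prop}
    (hstep : ∀ k, ∃ β : ι → ℝ,
      (∀ i, ∃ t : ℕ, β i = η ^ t * Real.sqrt (α k i ^ 2 + slack k) ∧ Acc k i (β i)) ∧
      ∀ i, IsLeast (β '' {j | j = i ∨ G.Adj i j}) (α (k + 1) i)) :
    ∃ N, ∀ k, N ≤ k → (∀ i j, α k i = α k j) ∧ (∀ i, α (k + 1) i ^ 2 = α k i ^ 2 + slack k) ∧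
      ∀ i, Acc k i (α (k + 1) i) := by
  choose β hβ hmin using hstep
  have hpos : ∀ k i, 0 < α k i := fun k i => hb.trans_le (hα k i)
  have hβe : ∀ᶠ k in atTop, ∀ i, β k i = Real.sqrt (α k i ^ 2 + slack k) := by
    rw [eventually_all]
    intro i
    exact eventually_sq_eq_of_backtracking (u := fun k => α k i) (β := fun k => β k i) hη hb hs
      hsum (fun k => hα k i) (fun k => (hβ k i).imp fun _ h => h.1)
      (fun k => (hmin k i).2 ⟨i, Or.inl rfl, rfl⟩)
  obtain ⟨N₀, hN₀⟩ := eventually_atTop.1 hβe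
  have hβsq : ∀ k, N₀ ≤ k → ∀ i, β k i ^ 2 = α k i ^ 2 + slack k := fun k hk i => by
    rw [hN₀ k hk i, Real.sq_sqrt (add_nonneg (sq_nonneg _) (hs k))]
  have hβnn : ∀ k, N₀ ≤ k → ∀ i, 0 ≤ β k i := fun k hk i => hN₀ k hk i ▸ Real.sqrt_nonneg _
  -- Without reductions, squared stepsizes minus the accumulated slack evolve by neighbourhood
  -- minima alone.
  obtain ⟨N₁, hN₁⟩ := eventually_eq_of_min_neighbors hG
    (v := fun n i => α (N₀ + n) i ^ 2 - ∑ t ∈ Finset.range (N₀ + n), slack t)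
    (fun k i j hij => by
      have h1 : α (N₀ + k + 1) i ≤ β (N₀ + k) j := (hmin (N₀ + k) i).2 ⟨j, hij, rfl⟩
      have h2 := pow_le_pow_left₀ (hpos _ _).le h1 2
      rw [hβsq _ (by omega)] at h2
      simp only [← add_assoc, Finset.sum_range_succ _ (N₀ + k)]
      linarith)
    (fun k i => by
      obtain ⟨j, -, hj⟩ := (hmin (N₀ + k) i).1
      refine ⟨j, ?_⟩
      have h2 := hβsq (N₀ + k) (by omega) j
      rw [hj] at h2
      simp only [← add_assoc, Finset.sum_range_succ _ (N₀ + k)]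
      linarith)
  have heq : ∀ k, N₀ + N₁ ≤ k → ∀ i j, α k i = α k j := by
    intro k hk i j
    obtain ⟨n, rfl⟩ := Nat.exists_eq_add_of_le (le_of_add_le_left hk)
    have := hN₁ n (by omega) i j
    simp only [sub_left_inj] at this
    exact (pow_left_inj₀ (hpos _ _).le (hpos _ _).le two_ne_zero).1 this
  have hαβ : ∀ k, N₀ + N₁ ≤ k → ∀ i, α (k + 1) i = β k i := by
    intro k hk i
    obtain ⟨j, -, hj⟩ := (hmin k i).1
    rw [← hj, hN₀ k (by omega), hN₀ k (by omega), heq k hk i j]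
  refine ⟨N₀ + N₁, fun k hk => ⟨heq k hk, fun i => ?_, fun i => ?_⟩⟩
  · rw [hαβ k hk i, hβsq k (by omega)]
  · rw [hαβ k hk i]
    exact (hβ k i).elim fun _ h => h.2

end MinConsensus

/-! ### Mixing of rows -/

section Rows

variable {m d : ℕ}

@[simp] theorem rowMix_apply (W : Matrix (Fin m) (Fin m) ℝ) (X : Stack m d) (i : Fin m) :
    rowMix W X i = ∑ j, W i j • X j := rfl

@[simp] theorem rowScale_apply (a : Fin m → ℝ) (X : Stack m d) (i : Fin m) :
    rowScale a X i = a i • X i := rfl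

theorem rowMix_add (W : Matrix (Fin m) (Fin m) ℝ) (X Y : Stack m d) :
    rowMix W (X + Y) = rowMix W X + rowMix W Y := by
  ext1 i
  simp [smul_add, Finset.sum_add_distrib]

theorem rowMix_smul (W : Matrix (Fin m) (Fin m) ℝ) (c : ℝ) (X : Stack m d) :
    rowMix W (c • X) = c • rowMix W X := by
  ext1 i
  simp only [rowMix_apply, PiLp.smul_apply, Finset.smul_sum]
  exact Finset.sum_congr rfl fun j _ => smul_comm _ _ _

theorem rowMix_neg (W : Matrix (Fin m) (Fin m) ℝ) (X : Stack m d) :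
    rowMix W (-X) = -rowMix W X := by
  rw [← neg_one_smul ℝ X, rowMix_smul, neg_one_smul]

theorem rowMix_sub (W : Matrix (Fin m) (Fin m) ℝ) (X Y : Stack m d) :
    rowMix W (X - Y) = rowMix W X - rowMix W Y := by
  rw [sub_eq_add_neg, rowMix_add, rowMix_neg, ← sub_eq_add_neg]

theorem rowMix_zero (W : Matrix (Fin m) (Fin m) ℝ) : rowMix W (0 : Stack m d) = 0 := by
  simpa using rowMix_sub W (0 : Stack m d) 0

theorem sub_rowMix (W W' : Matrix (Fin m) (Fin m) ℝ) (X : Stack m d) :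
    rowMix (W - W') X = rowMix W X - rowMix W' X := by
  ext1 i
  simp [sub_smul, Finset.sum_sub_distrib]

theorem one_rowMix (X : Stack m d) : rowMix 1 X = X := by
  ext1 i
  simp [Matrix.one_apply, ite_smul]

theorem rowMix_rowMix (W W' : Matrix (Fin m) (Fin m) ℝ) (X : Stack m d) :
    rowMix W (rowMix W' X) = rowMix (W * W') X := by
  ext1 i
  simp only [rowMix_apply, Matrix.mul_apply, Finset.sum_smul, Finset.smul_sum, smul_smul]
  exact Finset.sum_comm

theorem inner_rowMix {W : Matrix (Fin m) (Fin m) ℝ} (hW : W.IsSymm) (X Y : Stack m d) :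
    inner ℝ (rowMix W X) Y = inner ℝ X (rowMix W Y) := by
  rw [PiLp.inner_apply, PiLp.inner_apply]
  simp only [rowMix_apply, sum_inner, inner_sum, real_inner_smul_left, real_inner_smul_right]
  rw [Finset.sum_comm]
  refine Finset.sum_congr rfl fun j _ => Finset.sum_congr rfl fun i _ => ?_
  rw [hW.apply]

theorem rowScale_const {a : Fin m → ℝ} {c : ℝ} (h : ∀ i, a i = c) (X : Stack m d) :
    rowScale a X = c • X := by
  ext1 i
  simp [h i]

theorem continuous_rowMix (W : Matrix (Fin m) (Fin m) ℝ) :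
    Continuous fun X : Stack m d => rowMix W X :=
  (PiLp.continuous_toLp 2 _).comp <| continuous_pi fun i =>
    continuous_finsetSum _ fun j _ => (PiLp.continuous_apply 2 _ j).const_smul (W i j)

/-- The lifted consensus subspace. -/
def consSet (Lc Mc : Matrix (Fin m) (Fin m) ℝ) : Set (Lifted m d) :=
  {x | rowMix Lc x.fst + rowMix Mc x.snd = 0}

theorem isClosed_consSet (Lc Mc : Matrix (Fin m) (Fin m) ℝ) :
    IsClosed (consSet Lc Mc : Set (Lifted m d)) :=
  isClosed_eq (((continuous_rowMix Lc).comp (WithLp.continuous_fst 2 _ _)).add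
    ((continuous_rowMix Mc).comp (WithLp.continuous_snd 2 _ _))) continuous_const

theorem consSet_add {Lc Mc : Matrix (Fin m) (Fin m) ℝ} {x y : Lifted m d}
    (hx : x ∈ consSet Lc Mc) (hy : y ∈ consSet Lc Mc) : x + y ∈ consSet Lc Mc := by
  have e : rowMix Lc (x + y).fst + rowMix Mc (x + y).snd =
      (rowMix Lc x.fst + rowMix Mc x.snd) + (rowMix Lc y.fst + rowMix Mc y.snd) := by
    rw [WithLp.add_fst, WithLp.add_snd, rowMix_add, rowMix_add]; abel
  change _ = _ at hx hy
  change _ = _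
  rw [e, hx, hy, add_zero]

theorem consSet_smul {Lc Mc : Matrix (Fin m) (Fin m) ℝ} {x : Lifted m d} (c : ℝ)
    (hx : x ∈ consSet Lc Mc) : c • x ∈ consSet Lc Mc := by
  change _ = _ at hx
  change _ = _
  rw [WithLp.smul_fst, WithLp.smul_snd, rowMix_smul, rowMix_smul, ← smul_add, hx, smul_zero]

theorem zero_mem_consSet (Lc Mc : Matrix (Fin m) (Fin m) ℝ) :
    (0 : Lifted m d) ∈ consSet Lc Mc := by
  change rowMix Lc 0 + rowMix Mc 0 = 0
  rw [rowMix_zero, rowMix_zero, add_zero]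

theorem consSet_sub {Lc Mc : Matrix (Fin m) (Fin m) ℝ} {x y : Lifted m d}
    (hx : x ∈ consSet Lc Mc) (hy : y ∈ consSet Lc Mc) : x - y ∈ consSet Lc Mc := by
  rw [sub_eq_add_neg, ← neg_one_smul ℝ y]
  exact consSet_add hx (consSet_smul _ hy)

theorem consSet_sum {Lc Mc : Matrix (Fin m) (Fin m) ℝ} {κ : Type*} (T : Finset κ) (w : κ → ℝ)
    {z : κ → Lifted m d} (hz : ∀ t ∈ T, z t ∈ consSet Lc Mc) :
    ∑ t ∈ T, w t • z t ∈ consSet Lc Mc := by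
  classical
  induction T using Finset.induction_on with
  | empty => simpa using zero_mem_consSet Lc Mc
  | insert t T ht ih =>
    rw [Finset.sum_insert ht]
    exact consSet_add (consSet_smul _ (hz t (Finset.mem_insert_self t T)))
      (ih fun s hs => hz s (Finset.mem_insert_of_mem hs))

variable {W Lc Mc : Matrix (Fin m) (Fin m) ℝ}

theorem IsBCVPair.metric_symm (h : IsBCVPair W Lc Mc) : Mc.IsSymm := by
  have := h.posDef.isHermitian
  rwa [Matrix.IsHermitian, Matrix.conjTranspose_eq_transpose_of_trivial] at this

theorem IsBCVPair.metric_mul_inv (h : IsBCVPair W Lc Mc) : Mc * Mc⁻¹ = 1 :=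
  Matrix.mul_nonsing_inv _ ((Matrix.isUnit_iff_isUnit_det _).1 h.posDef.isUnit)

theorem IsBCVPair.inv_mul_metric (h : IsBCVPair W Lc Mc) : Mc⁻¹ * Mc = 1 :=
  Matrix.nonsing_inv_mul _ ((Matrix.isUnit_iff_isUnit_det _).1 h.posDef.isUnit)

theorem IsBCVPair.metric_sq (h : IsBCVPair W Lc Mc) : Mc * Mc = W := by
  rw [h.metric_sq_eq, h.sq_eq]; abel

theorem IsBCVPair.commute (h : IsBCVPair W Lc Mc) : Lc * W = W * Lc := by
  have : W = 1 - Lc * Lc := by rw [h.sq_eq]; abel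
  rw [this, mul_sub, sub_mul, mul_one, one_mul, mul_assoc]

theorem IsBCVPair.liftedA_mem (h : IsBCVPair W Lc Mc) (A : ℕ → Stack m d) (k : ℕ) :
    liftedA Lc Mc A k ∈ consSet Lc Mc := by
  change rowMix Lc (A k) + rowMix Mc (-rowMix (Mc⁻¹ * Lc) (A k)) = 0
  rw [rowMix_neg, rowMix_rowMix, ← mul_assoc, h.metric_mul_inv, one_mul, add_neg_cancel]

/-- The lower block of a point of the consensus subspace is determined by the upper one. -/
theorem IsBCVPair.eq_of_mem (h : IsBCVPair W Lc Mc) {U Z : Stack m d}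
    (hz : rowMix Lc U + rowMix Mc Z = 0) : Z = -rowMix (Mc⁻¹ * Lc) U := by
  have h1 : rowMix Mc⁻¹ (rowMix Lc U + rowMix Mc Z) = 0 := by rw [hz, rowMix_zero]
  rw [rowMix_add, rowMix_rowMix, rowMix_rowMix, h.inv_mul_metric, one_rowMix] at h1
  exact eq_neg_of_add_eq_zero_right h1

end Rows

/-! ### The lifted iteration -/

section Lifted

variable {m d : ℕ} {G : SimpleGraph (Fin m)} {W Lc Mc : Matrix (Fin m) (Fin m) ℝ}
  {f : Fin m → EuclideanSpace ℝ (Fin d) → ℝ} {r : Fin m → EuclideanSpace ℝ (Fin d) → EReal}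
  {η δ : ℝ} {slack : ℕ → ℝ} {α : ℕ → Fin m → ℝ} {X A S D : ℕ → Stack m d}

/-- Only `Lc * Lc = 1 - W` is needed, so this holds from the start, before the stepsizes agree. -/
theorem IsLocalDATOS.D_eq (h : IsLocalDATOS G W f r η δ slack α X A S D)
    (hLM : IsBCVPair W Lc Mc) (k : ℕ) : D k = rowMix Lc (dualY f Lc α X S D k) := by
  induction k with
  | zero => rw [h.init_D, dualY, rowMix_zero]
  | succ k ih =>
    have e : W = 1 - Lc * Lc := by rw [hLM.sq_eq]; abel
    rw [h.update_D, dualY, rowMix_add, ← ih, rowMix_rowMix, halfD, hLM.sq_eq]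
    simp only [sub_rowMix, rowMix_sub, rowMix_add, one_rowMix]
    abel

/-- `X - τ (∇F(X) + S + D)`, the point before mixing. -/
theorem IsLocalDATOS.A_eq (h : IsLocalDATOS G W f r η δ slack α X A S D) {k : ℕ} {τ : ℝ}
    (hτ : ∀ i, α (k + 1) i = τ) :
    A (k + 1) = rowMix W (X k - τ • (gradLoss f (X k) + S k + D k)) := by
  rw [h.update_A, rowScale_const hτ, halfD, rowMix_sub, rowMix_smul]

theorem dualY_succ_eq {k : ℕ} {τ : ℝ} (hτ : ∀ i, α (k + 1) i = τ) (hτ0 : τ ≠ 0) :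
    τ • (dualY f Lc α X S D (k + 1) - dualY f Lc α X S D k) =
      rowMix Lc (X k - τ • (gradLoss f (X k) + S k + D k)) := by
  rw [dualY, add_sub_cancel_left, ← rowMix_smul,
    rowScale_const (c := τ⁻¹) (fun i => by rw [hτ i])]
  congr 1
  simp only [smul_sub, smul_add, smul_inv_smul₀ hτ0]
  abel

/-- As `Lc² + Mc² = 1` and `Mc² = W`, the orthogonal projection of `(U, 0)` onto the consensus
subspace is `(W U, -Mc Lc U)`. The upper block is the update of `A`, and the subspace determines the
lower one. -/
theorem IsLocalDATOS.liftedA_eq (h : IsLocalDATOS G W f r η δ slack α X A S D)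
    (hLM : IsBCVPair W Lc Mc) {k : ℕ} {τ : ℝ} (hτ : ∀ i, α (k + 1) i = τ) :
    liftedA Lc Mc A (k + 1) = block (A (k + 1))
      (-rowMix Mc (rowMix Lc (X k - τ • (gradLoss f (X k) + S k + D k)))) := by
  have : -rowMix Mc (rowMix Lc (X k - τ • (gradLoss f (X k) + S k + D k))) =
      -rowMix (Mc⁻¹ * Lc) (A (k + 1)) := by
    refine hLM.eq_of_mem ?_
    rw [h.A_eq hτ, rowMix_neg, rowMix_rowMix, rowMix_rowMix, rowMix_rowMix,
      hLM.metric_sq, hLM.commute, add_neg_cancel]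
  rw [this]
  rfl

theorem IsLocalDATOS.lifted_dual_update (h : IsLocalDATOS G W f r η δ slack α X A S D)
    (hLM : IsBCVPair W Lc Mc) {k : ℕ} {τ : ℝ} (hτ : ∀ i, α (k + 1) i = τ) (hτ0 : τ ≠ 0) :
    liftedA Lc Mc A (k + 1) - liftedX X (k + 1) =
      τ • (liftedS f Lc Mc α X S D (k + 1) - liftedS f Lc Mc α X S D k) := by
  rw [h.liftedA_eq hLM hτ, ← dualY_succ_eq (Lc := Lc) hτ hτ0]
  have h1 : A (k + 1) - X (k + 1) = τ • (S (k + 1) - S k) := by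
    rw [h.update_S, add_sub_cancel_left,
      rowScale_const (c := τ⁻¹) (fun i => by rw [hτ i]), smul_inv_smul₀ hτ0]
  have h2 : -rowMix Mc (τ • (dualY f Lc α X S D (k + 1) - dualY f Lc α X S D k)) - 0 =
      τ • (-rowMix Mc (dualY f Lc α X S D (k + 1)) - -rowMix Mc (dualY f Lc α X S D k)) := by
    rw [rowMix_smul, rowMix_sub, sub_zero, ← smul_neg]
    congr 1
    abel
  exact congrArg₂ block h1 h2

/-- The residual has the form `(Lc q, Mc q)`, which by symmetry is orthogonal to the kernel of `(U,
Z) ↦ Lc U + Mc Z`. -/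
theorem IsLocalDATOS.lifted_projection (h : IsLocalDATOS G W f r η δ slack α X A S D)
    (hLM : IsBCVPair W Lc Mc) {k : ℕ} {τ : ℝ} (hτ : ∀ i, α (k + 1) i = τ) {v : Lifted m d}
    (hv : v ∈ consSet Lc Mc) :
    inner ℝ (liftedX X k - τ • block (gradLoss f (X k)) 0 - τ • liftedS f Lc Mc α X S D k
      - liftedA Lc Mc A (k + 1)) v = 0 := by
  set q : Stack m d := rowMix Lc (X k - τ • (gradLoss f (X k) + S k + D k))
    + τ • dualY f Lc α X S D k with hq
  have h1 : X k - τ • gradLoss f (X k) - τ • S k - A (k + 1) = rowMix Lc q := by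
    have e : W = 1 - Lc * Lc := by rw [hLM.sq_eq]; abel
    rw [hq, rowMix_add, rowMix_smul, ← h.D_eq hLM k, rowMix_rowMix, h.A_eq hτ]
    nth_rw 1 [e]
    rw [sub_rowMix, one_rowMix, smul_add, smul_add]
    abel
  have h2 : (0 : Stack m d) - τ • 0 - τ • -rowMix Mc (dualY f Lc α X S D k)
      - -rowMix Mc (rowMix Lc (X k - τ • (gradLoss f (X k) + S k + D k))) = rowMix Mc q := by
    rw [hq, rowMix_add, rowMix_smul, smul_neg, smul_zero]
    abel
  have h3 : liftedX X k - τ • block (gradLoss f (X k)) 0 - τ • liftedS f Lc Mc α X S D k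
      - liftedA Lc Mc A (k + 1) = block (rowMix Lc q) (rowMix Mc q) := by
    rw [h.liftedA_eq hLM hτ]
    exact congrArg₂ block h1 h2
  rw [h3, WithLp.prod_inner_apply]
  change inner ℝ (rowMix Lc q) v.fst + inner ℝ (rowMix Mc q) v.snd = 0
  rw [inner_rowMix hLM.symm, inner_rowMix hLM.metric_symm, ← inner_add_right]
  change _ = _ at hv
  rw [hv, inner_zero_right]

/-! ### Losses -/

/-- On the line through `x` and `y`, the derivative at `0` is at most the slope of the chord to `1`.
-/
theorem ConvexOn.add_inner_gradient_le {E : Type*} [NormedAddCommGroup E]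
    [InnerProductSpace ℝ E] [CompleteSpace E] {g : E → ℝ} (hg : ConvexOn ℝ Set.univ g)
    {x : E} (hd : DifferentiableAt ℝ g x) (y : E) :
    g x + inner ℝ (gradient g x) (y - x) ≤ g y := by
  have hφ : ConvexOn ℝ Set.univ fun t : ℝ => g (x + t • (y - x)) := by
    have := hg.comp_affineMap (AffineMap.lineMap x y : ℝ →ᵃ[ℝ] E)
    simp only [Set.preimage_univ] at this
    refine this.congr fun t _ => ?_
    simp [AffineMap.lineMap_apply, add_comm]
  have hline : HasDerivAt (fun t : ℝ => x + t • (y - x)) (y - x) 0 := by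
    simpa using ((hasDerivAt_id (0 : ℝ)).smul_const (y - x)).const_add x
  have hder : HasDerivAt (fun t : ℝ => g (x + t • (y - x))) (inner ℝ (gradient g x) (y - x)) 0 := by
    have h1 : HasFDerivAt g (InnerProductSpace.toDual ℝ E (gradient g x)) (x + (0 : ℝ) • (y - x)) := by
      simpa using hd.hasGradientAt.hasFDerivAt
    have h2 := h1.comp_hasDerivAt (0 : ℝ) hline
    rwa [InnerProductSpace.toDual_apply_apply] at h2
  have := hφ.le_slope_of_hasDerivAt (Set.mem_univ 0) (Set.mem_univ 1) one_pos hder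
  simp only [slope_def_field, sub_zero, div_one, one_smul, add_sub_cancel, zero_smul,
    add_zero] at this
  linarith

theorem ObjectiveAssumptions.add_inner_gradLoss_le (hfr : ObjectiveAssumptions f r)
    (U Z : Stack m d) : sumLoss f U + inner ℝ (gradLoss f U) (Z - U) ≤ sumLoss f Z := by
  rw [sumLoss, sumLoss, PiLp.inner_apply, ← Finset.sum_add_distrib]
  exact Finset.sum_le_sum fun i _ =>
    (hfr.f_convex i).add_inner_gradient_le (hfr.f_differentiable i _) _

theorem ObjectiveAssumptions.continuous_sumLoss (hfr : ObjectiveAssumptions f r) :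
    Continuous fun x : Lifted m d => sumLoss f x.fst := by
  unfold sumLoss
  refine continuous_finsetSum _ fun i _ => (hfr.f_differentiable i).continuous.comp ?_
  exact (PiLp.continuous_apply 2 _ i).comp (WithLp.continuous_fst 2 _ _)

theorem ObjectiveAssumptions.convexOn_sumLoss (hfr : ObjectiveAssumptions f r) :
    ConvexOn ℝ Set.univ fun x : Lifted m d => sumLoss f x.fst := by
  refine ⟨convex_univ, fun x _ y _ a b ha hb hab => ?_⟩
  simp only [sumLoss, smul_eq_mul, Finset.mul_sum, ← Finset.sum_add_distrib]
  exact Finset.sum_le_sum fun i _ => (hfr.f_convex i).2 (Set.mem_univ _) (Set.mem_univ _) ha hb hab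

theorem IsLocalDATOS.descent (h : IsLocalDATOS G W f r η δ slack α X A S D) {k : ℕ} {τ : ℝ}
    (hτ : ∀ i, α (k + 1) i = τ)
    (hacc : ∀ i, LinesearchAccepts (f i) (X k i) (rowMix W (X k) i)
      (-(halfD f W (X k) (S k) (D k) i)) δ τ) :
    sumLoss f (A (k + 1)) ≤ sumLoss f (X k) + inner ℝ (gradLoss f (X k)) (A (k + 1) - X k)
      + δ / (2 * τ) * ‖A (k + 1) - X k‖ ^ 2 := by
  have hA : ∀ i, A (k + 1) i = rowMix W (X k) i + τ • -(halfD f W (X k) (S k) (D k) i) := fun i => by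
    rw [h.update_A, rowScale_const hτ, smul_neg, ← sub_eq_add_neg]
    rfl
  rw [sumLoss, sumLoss, PiLp.inner_apply, PiLp.norm_sq_eq_of_L2, Finset.mul_sum,
    ← Finset.sum_add_distrib, ← Finset.sum_add_distrib]
  refine Finset.sum_le_sum fun i _ => ?_
  have := hacc i
  rw [LinesearchAccepts, ← hA i] at this
  exact this

theorem lifted_norm_sq (x : Lifted m d) : ‖x‖ ^ 2 = ‖x.fst‖ ^ 2 + ‖x.snd‖ ^ 2 :=
  WithLp.prod_norm_sq_eq_of_L2 x

end Lifted

/-! ### Extended-real-valued convex analysis -/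

section EReals

theorem ereal_coe_sum {ι : Type*} (T : Finset ι) (v : ι → ℝ) :
    ((∑ i ∈ T, v i : ℝ) : EReal) = ∑ i ∈ T, (v i : EReal) := by
  classical
  induction T using Finset.induction_on with
  | empty => simp
  | insert i T hi ih => rw [Finset.sum_insert hi, Finset.sum_insert hi, EReal.coe_add, ih]

theorem ereal_sum_ne_bot {ι : Type*} (T : Finset ι) {g : ι → EReal} (hg : ∀ i, g i ≠ ⊥) :
    ∑ i ∈ T, g i ≠ ⊥ := by
  classical
  induction T using Finset.induction_on with
  | empty => simp
  | insert i T hi ih =>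
    rw [Finset.sum_insert hi]
    exact EReal.add_ne_bot_iff.2 ⟨hg i, ih⟩

theorem ereal_sum_eq_top_or {ι : Type*} (T : Finset ι) {g : ι → EReal} (hg : ∀ i, g i ≠ ⊥) :
    ∑ i ∈ T, g i = ⊤ ∨ ∃ v : ι → ℝ, ∀ i ∈ T, g i = v i := by
  classical
  by_cases h : ∀ i ∈ T, g i ≠ ⊤
  · exact Or.inr ⟨fun i => (g i).toReal, fun i hi => (EReal.coe_toReal (h i hi) (hg i)).symm⟩
  · push Not at h
    obtain ⟨j, hj, hjt⟩ := h
    left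
    rw [← Finset.add_sum_erase T g hj, hjt, EReal.top_add_of_ne_bot (ereal_sum_ne_bot _ hg)]

/-- The optimality condition of a proximal step, stated on the epigraph. -/
theorem IsProx.subgradient {E : Type*} [NormedAddCommGroup E] [InnerProductSpace ℝ E] {τ : ℝ}
    (hτ : 0 < τ) {g : E → EReal} (hg : IsConvexProperLsc g) {x p : E} (hp : IsProx τ g x p) :
    ∃ b : ℝ, g p = b ∧ ∀ (y : E) (v : ℝ), g y ≤ v → b + inner ℝ (τ⁻¹ • (x - p)) (y - p) ≤ v := by
  have htop : g p ≠ ⊤ := by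
    obtain ⟨y, hy⟩ := hg.exists_ne_top
    intro h
    have h1 := hp y
    rw [h, EReal.top_add_coe, ← EReal.coe_toReal hy (hg.ne_bot y), ← EReal.coe_add,
      top_le_iff] at h1
    exact EReal.coe_ne_top _ h1
  obtain ⟨b, hb⟩ : ∃ b : ℝ, g p = b := ⟨_, (EReal.coe_toReal htop (hg.ne_bot p)).symm⟩
  refine ⟨b, hb, fun y v hv => ?_⟩
  -- Compare `p` with `(1 - t) p + t y` in the proximal problem, use convexity of the epigraph and
  -- divide by `t`; the error is linear in `t` and disappears as `t → 0`.
  have hineq : ∀ t : ℝ, 0 < t → t ≤ 1 →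
      b + inner ℝ (τ⁻¹ • (x - p)) (y - p) ≤ v + t * (1 / (2 * τ) * ‖y - p‖ ^ 2) := by
    intro t ht0 ht1
    have hc := hg.convex_epigraph (x := (p, b)) (y := (y, v)) (by simp [hb]) hv
      (sub_nonneg.2 ht1) ht0.le (by ring)
    simp only [Set.mem_ofPred_eq, Prod.smul_mk, Prod.mk_add_mk, smul_eq_mul] at hc
    have h1 := (hp _).trans (add_le_add_left hc _)
    rw [hb, ← EReal.coe_add, ← EReal.coe_add, EReal.coe_le_coe_iff] at h1
    have e : x - ((1 - t) • p + t • y) = (x - p) - t • (y - p) := by module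
    rw [e, norm_sub_sq_real (x - p), norm_smul, real_inner_smul_right, mul_pow, Real.norm_eq_abs,
      sq_abs] at h1
    rw [real_inner_smul_left]
    have e2 : 1 / (2 * τ) * (2 * (t * inner ℝ (x - p) (y - p))) =
      t * (τ⁻¹ * inner ℝ (x - p) (y - p)) := by field_simp
    have h2 : t * (b + τ⁻¹ * inner ℝ (x - p) (y - p)) ≤
        t * (v + t * (1 / (2 * τ) * ‖y - p‖ ^ 2)) := by
      nlinarith
    exact le_of_mul_le_mul_left h2 ht0
  have hlim : Tendsto (fun t : ℝ => v + t * (1 / (2 * τ) * ‖y - p‖ ^ 2)) (𝓝[>] 0) (𝓝 v) := by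
    have : Tendsto (fun t : ℝ => v + t * (1 / (2 * τ) * ‖y - p‖ ^ 2)) (𝓝 0)
        (𝓝 (v + 0 * (1 / (2 * τ) * ‖y - p‖ ^ 2))) :=
      (tendsto_id.mul_const _).const_add _
    rw [zero_mul, add_zero] at this
    exact this.mono_left nhdsWithin_le_nhds
  refine ge_of_tendsto hlim ?_
  filter_upwards [Ioc_mem_nhdsGT (zero_lt_one' ℝ)] with t ht using hineq t ht.1 ht.2

variable {E : Type*} [NormedAddCommGroup E] [InnerProductSpace ℝ E] {g : E → EReal}

theorem fenchel_le_iff (hg : ∀ x, g x ≠ ⊥) {s : E} {c : ℝ} :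
    fenchel g s ≤ c ↔ ∀ (y : E) (v : ℝ), g y = v → inner ℝ s y - v ≤ c := by
  rw [fenchel, iSup_le_iff]
  refine forall_congr' fun y => ⟨fun h v hv => ?_, fun h => ?_⟩
  · rw [hv, ← EReal.coe_sub, EReal.coe_le_coe_iff] at h
    exact h
  · by_cases hy : g y = ⊤
    · rw [hy, EReal.sub_top]
      exact bot_le
    · have hv := (EReal.coe_toReal hy (hg y)).symm
      rw [hv, ← EReal.coe_sub, EReal.coe_le_coe_iff]
      exact h _ hv

/-- The effective domain of the Fenchel conjugate. -/
def conjDom (g : E → EReal) : Set E := {s | fenchel g s ≠ ⊤}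

/-- The Fenchel conjugate as a real-valued function on its effective domain. -/
noncomputable def conjVal (g : E → EReal) (s : E) : ℝ := (fenchel g s).toReal

theorem fenchel_ne_bot (hx : ∃ x, ∃ v : ℝ, g x = v) (s : E) : fenchel g s ≠ ⊥ := by
  obtain ⟨x, v, hv⟩ := hx
  have h : ((inner ℝ s x : ℝ) : EReal) - g x ≤ fenchel g s :=
    le_iSup (fun x => ((inner ℝ s x : ℝ) : EReal) - g x) x
  rw [hv, ← EReal.coe_sub] at h
  exact fun h' => EReal.coe_ne_bot _ (le_bot_iff.1 (h' ▸ h))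

theorem fenchel_eq_conjVal (hx : ∃ x, ∃ v : ℝ, g x = v) {s : E} (hs : s ∈ conjDom g) :
    fenchel g s = conjVal g s :=
  (EReal.coe_toReal hs (fenchel_ne_bot hx s)).symm

theorem inner_sub_le_conjVal {x : E} {v : ℝ} (hv : g x = v) {s : E} (hs : s ∈ conjDom g) :
    inner ℝ s x - v ≤ conjVal g s := by
  have h : ((inner ℝ s x : ℝ) : EReal) - g x ≤ fenchel g s :=
    le_iSup (fun x => ((inner ℝ s x : ℝ) : EReal) - g x) x
  rwa [hv, fenchel_eq_conjVal ⟨x, v, hv⟩ hs, ← EReal.coe_sub, EReal.coe_le_coe_iff] at h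

theorem conjVal_le_of_fenchel_le (hx : ∃ x, ∃ v : ℝ, g x = v) {s : E} {c : ℝ}
    (h : fenchel g s ≤ c) : s ∈ conjDom g ∧ conjVal g s ≤ c := by
  have hs : s ∈ conjDom g := ne_top_of_le_ne_top (EReal.coe_ne_top c) h
  rw [fenchel_eq_conjVal hx hs, EReal.coe_le_coe_iff] at h
  exact ⟨hs, h⟩

/-- The conjugate is a supremum of affine functions, and each of these inequalities passes to the
limit. Finiteness at `q` is a conclusion, since the effective domain need not be closed. -/
theorem conjVal_lsc (hg : ∀ x, g x ≠ ⊥) (hx : ∃ x, ∃ v : ℝ, g x = v) {p : ℕ → E} {c : ℕ → ℝ}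
    {q : E} {b : ℝ} (hp : ∀ k, p k ∈ conjDom g) (hc : ∀ k, conjVal g (p k) ≤ c k)
    (hpq : Tendsto p atTop (𝓝 q)) (hcb : Tendsto c atTop (𝓝 b)) :
    q ∈ conjDom g ∧ conjVal g q ≤ b := by
  refine conjVal_le_of_fenchel_le hx ((fenchel_le_iff hg).2 fun y v hv => ?_)
  exact le_of_tendsto_of_tendsto' ((hpq.inner tendsto_const_nhds).sub_const v) hcb
    fun k => (inner_sub_le_conjVal hv (hp k)).trans (hc k)

theorem conjVal_sum_le (hg : ∀ x, g x ≠ ⊥) (hx : ∃ x, ∃ v : ℝ, g x = v) {κ : Type*}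
    {T : Finset κ} {w : κ → ℝ} (hw : ∀ t ∈ T, 0 ≤ w t) (hw1 : ∑ t ∈ T, w t = 1) {p : κ → E}
    (hp : ∀ t ∈ T, p t ∈ conjDom g) :
    ∑ t ∈ T, w t • p t ∈ conjDom g ∧
      conjVal g (∑ t ∈ T, w t • p t) ≤ ∑ t ∈ T, w t * conjVal g (p t) := by
  refine conjVal_le_of_fenchel_le hx ((fenchel_le_iff hg).2 fun y v hv => ?_)
  have e : inner ℝ (∑ t ∈ T, w t • p t) y - v = ∑ t ∈ T, w t * (inner ℝ (p t) y - v) := by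
    simp only [mul_sub, Finset.sum_sub_distrib, ← Finset.sum_mul, hw1, one_mul, sum_inner,
      real_inner_smul_left]
  rw [e]
  exact Finset.sum_le_sum fun t ht =>
    mul_le_mul_of_nonneg_left (inner_sub_le_conjVal hv (hp t ht)) (hw t ht)

/-- Equality in the Fenchel-Young inequality makes `x` a subgradient of the conjugate. -/
theorem conjVal_subgradient (hg : ∀ x, g x ≠ ⊥) {x s : E} {b : ℝ} (hb : g x = b)
    (h : ∀ (y : E) (v : ℝ), g y = v → b + inner ℝ s (y - x) ≤ v) :
    s ∈ conjDom g ∧ ∀ p ∈ conjDom g, conjVal g s + inner ℝ x (p - s) ≤ conjVal g p := by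
  obtain ⟨hs, hle⟩ := conjVal_le_of_fenchel_le (c := inner ℝ s x - b) ⟨x, b, hb⟩
    ((fenchel_le_iff hg).2 fun y v hv => by
      have := h y v hv
      rw [inner_sub_right] at this
      linarith)
  refine ⟨hs, fun p hp => ?_⟩
  have := inner_sub_le_conjVal hb hp
  rw [inner_sub_right, real_inner_comm p x, real_inner_comm s x]
  linarith

end EReals

/-! ### The lifted regularizer and the Lagrangian -/

section Lagrangian

variable {m d : ℕ} {W Lc Mc : Matrix (Fin m) (Fin m) ℝ}
  {f : Fin m → EuclideanSpace ℝ (Fin d) → ℝ} {r : Fin m → EuclideanSpace ℝ (Fin d) → EReal}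

theorem liftedReg_ne_bot (hr : ∀ i x, r i x ≠ ⊥) (x : Lifted m d) : liftedReg r x ≠ ⊥ := by
  refine EReal.add_ne_bot_iff.2 ⟨ereal_sum_ne_bot _ fun i => hr i _, ?_⟩
  unfold indicatorZero
  split_ifs <;> simp

theorem liftedReg_eq_coe {x : Lifted m d} (hx : x.snd = 0) {v : Fin m → ℝ}
    (hv : ∀ i, r i (x.fst i) = v i) : liftedReg r x = ((∑ i, v i : ℝ) : EReal) := by
  rw [liftedReg, indicatorZero, if_pos hx, add_zero, ereal_coe_sum]
  exact Finset.sum_congr rfl fun i _ => hv i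

theorem liftedReg_coe_iff (hr : ∀ i x, r i x ≠ ⊥) {x : Lifted m d} {c : ℝ}
    (h : liftedReg r x = c) :
    x.snd = 0 ∧ ∃ v : Fin m → ℝ, (∀ i, r i (x.fst i) = v i) ∧ c = ∑ i, v i := by
  have hx : x.snd = 0 := by
    by_contra hx
    rw [liftedReg, indicatorZero, if_neg hx,
      EReal.add_top_of_ne_bot (ereal_sum_ne_bot _ fun i => hr i _)] at h
    exact EReal.coe_ne_top _ h.symm
  refine ⟨hx, ?_⟩
  rcases ereal_sum_eq_top_or Finset.univ (g := fun i => r i (x.fst i)) (fun i => hr i _) with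
    htop | ⟨v, hv⟩
  · rw [liftedReg, htop, indicatorZero, if_pos hx, add_zero] at h
    exact absurd h.symm (EReal.coe_ne_top c)
  · refine ⟨v, fun i => hv i (Finset.mem_univ i), ?_⟩
    rw [liftedReg_eq_coe hx fun i => hv i (Finset.mem_univ i), EReal.coe_eq_coe_iff] at h
    exact h.symm

theorem ObjectiveAssumptions.r_ne_bot (hfr : ObjectiveAssumptions f r) (i : Fin m)
    (x : EuclideanSpace ℝ (Fin d)) : r i x ≠ ⊥ :=
  (hfr.r_convex_proper_lsc i).ne_bot x

theorem ObjectiveAssumptions.exists_liftedReg_eq_coe (hfr : ObjectiveAssumptions f r) :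
    ∃ x, ∃ v : ℝ, liftedReg r x = v := by
  choose y hy using fun i => (hfr.r_convex_proper_lsc i).exists_ne_top
  exact ⟨block (WithLp.toLp 2 y) 0, _, liftedReg_eq_coe rfl fun i =>
    (EReal.coe_toReal (hy i) (hfr.r_ne_bot i _)).symm⟩

theorem lagrangian_eq_coe (hfr : ObjectiveAssumptions f r) {x s : Lifted m d}
    (hx : x ∈ consSet Lc Mc) (hs : s ∈ conjDom (liftedReg r)) :
    lagrangian f r Lc Mc x s =
      (saddleValue (fun x => sumLoss f x.fst) (conjVal (liftedReg r)) x s : ℝ) := by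
  rw [lagrangian, liftedCons, indicatorZero, if_pos (show _ = _ from hx), add_zero,
    fenchel_eq_conjVal hfr.exists_liftedReg_eq_coe hs]
  rfl

theorem lagrangian_eq_bot {x s : Lifted m d} (hs : s ∉ conjDom (liftedReg r)) :
    lagrangian f r Lc Mc x s = ⊥ := by
  rw [lagrangian, not_not.1 hs, EReal.sub_top]

theorem lagrangian_eq_top (hfr : ObjectiveAssumptions f r) {x s : Lifted m d}
    (hx : x ∉ consSet Lc Mc) (hs : s ∈ conjDom (liftedReg r)) :
    lagrangian f r Lc Mc x s = ⊤ := by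
  rw [lagrangian, liftedCons, indicatorZero, if_neg (show ¬_ = _ from hx),
    fenchel_eq_conjVal hfr.exists_liftedReg_eq_coe hs, EReal.coe_add_top, EReal.top_add_coe,
    EReal.top_sub_coe]

/-- Saddle points of the Lagrangian are saddle points of its restriction to the effective domain. -/
theorem isSaddle_lagrangian_iff (hfr : ObjectiveAssumptions f r)
    (hne : (conjDom (liftedReg r)).Nonempty) {xs ss : Lifted m d} :
    IsSaddle (lagrangian f r Lc Mc) xs ss ↔
      xs ∈ consSet Lc Mc ∧ ss ∈ conjDom (liftedReg r) ∧
      ∀ u ∈ consSet Lc Mc, ∀ p ∈ conjDom (liftedReg r),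
        saddleValue (fun x => sumLoss f x.fst) (conjVal (liftedReg r)) xs p ≤
          saddleValue (fun x => sumLoss f x.fst) (conjVal (liftedReg r)) u ss := by
  obtain ⟨s₁, hs₁⟩ := hne
  constructor
  · rintro ⟨h1, h2⟩
    have hss : ss ∈ conjDom (liftedReg r) := by
      by_contra hss
      have h3 := h1 s₁
      rw [lagrangian_eq_bot hss, le_bot_iff] at h3
      by_cases hxs : xs ∈ consSet Lc Mc
      · rw [lagrangian_eq_coe hfr hxs hs₁] at h3
        exact EReal.coe_ne_bot _ h3
      · rw [lagrangian_eq_top hfr hxs hs₁] at h3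
        exact top_ne_bot h3
    have hxs : xs ∈ consSet Lc Mc := by
      by_contra hxs
      have h3 := h2 0
      rw [lagrangian_eq_top hfr hxs hss, lagrangian_eq_coe hfr (zero_mem_consSet _ _) hss,
        top_le_iff] at h3
      exact EReal.coe_ne_top _ h3
    refine ⟨hxs, hss, fun u hu p hp => ?_⟩
    have h3 := (h1 p).trans (h2 u)
    rwa [lagrangian_eq_coe hfr hxs hp, lagrangian_eq_coe hfr hu hss, EReal.coe_le_coe_iff] at h3
  · rintro ⟨hxs, hss, h⟩
    refine ⟨fun p => ?_, fun u => ?_⟩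
    · by_cases hp : p ∈ conjDom (liftedReg r)
      · rw [lagrangian_eq_coe hfr hxs hp, lagrangian_eq_coe hfr hxs hss, EReal.coe_le_coe_iff]
        exact h xs hxs p hp
      · rw [lagrangian_eq_bot hp]
        exact bot_le
    · by_cases hu : u ∈ consSet Lc Mc
      · rw [lagrangian_eq_coe hfr hxs hss, lagrangian_eq_coe hfr hu hss, EReal.coe_le_coe_iff]
        exact h u hu ss hss
      · rw [lagrangian_eq_top hfr hu hss]
        exact le_top

/-- Dual points outside the effective domain give `⊥` in the supremum and primal points outside the
subspace give `⊤` in the infimum, so real inequalities on the effective domain suffice. -/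
theorem partialGap_le (hfr : ObjectiveAssumptions f r) {BX BS : Set (Lifted m d)}
    {a s : Lifted m d} (ha : a ∈ consSet Lc Mc) (hs : s ∈ conjDom (liftedReg r)) {c : ℝ}
    (h : ∀ u ∈ BX, u ∈ consSet Lc Mc → ∀ p ∈ BS, p ∈ conjDom (liftedReg r) →
      saddleValue (fun x => sumLoss f x.fst) (conjVal (liftedReg r)) a p -
        saddleValue (fun x => sumLoss f x.fst) (conjVal (liftedReg r)) u s ≤ c) :
    partialGap (lagrangian f r Lc Mc) BX BS a s ≤ c := by
  refine EReal.sub_le_of_le_add (iSup₂_le fun p hpB => ?_)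
  by_cases hp : p ∈ conjDom (liftedReg r)
  · rw [lagrangian_eq_coe hfr ha hp]
    set v := saddleValue (fun x : Lifted m d => sumLoss f x.fst) (conjVal (liftedReg r)) a p
    have hI : ((v - c : ℝ) : EReal) ≤ ⨅ u ∈ BX, lagrangian f r Lc Mc u s := by
      refine le_iInf₂ fun u huB => ?_
      by_cases hu : u ∈ consSet Lc Mc
      · rw [lagrangian_eq_coe hfr hu hs, EReal.coe_le_coe_iff]
        linarith [h u huB hu p hpB hp]
      · rw [lagrangian_eq_top hfr hu hs]
        exact le_top
    calc (v : EReal) = (c : EReal) + ((v - c : ℝ) : EReal) := by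
          rw [← EReal.coe_add, add_sub_cancel]
      _ ≤ _ := by gcongr
  · rw [lagrangian_eq_bot hp]
    exact bot_le

theorem le_partialGap (hfr : ObjectiveAssumptions f r) {BX BS : Set (Lifted m d)}
    {a s u p : Lifted m d} (ha : a ∈ consSet Lc Mc) (hs : s ∈ conjDom (liftedReg r))
    (huB : u ∈ BX) (hu : u ∈ consSet Lc Mc) (hpB : p ∈ BS) (hp : p ∈ conjDom (liftedReg r)) :
    ((saddleValue (fun x => sumLoss f x.fst) (conjVal (liftedReg r)) a p -
        saddleValue (fun x => sumLoss f x.fst) (conjVal (liftedReg r)) u s : ℝ) : EReal) ≤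
      partialGap (lagrangian f r Lc Mc) BX BS a s := by
  rw [EReal.coe_sub, ← lagrangian_eq_coe hfr ha hp, ← lagrangian_eq_coe hfr hu hs]
  exact EReal.sub_le_sub (le_iSup₂ (f := fun p _ => lagrangian f r Lc Mc a p) p hpB)
    (iInf₂_le (f := fun u _ => lagrangian f r Lc Mc u s) u huB)

/-- On bounded sets that contain a saddle point the partial gap is a nonnegative real number. -/
theorem exists_partialGap_eq_coe (hfr : ObjectiveAssumptions f r) {R : ℝ}
    {a s xs ss : Lifted m d} (ha : a ∈ consSet Lc Mc) (hs : s ∈ conjDom (liftedReg r))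
    (hsad : IsSaddle (lagrangian f r Lc Mc) xs ss) (hxR : ‖xs‖ ≤ R) (hsR : ‖ss‖ ≤ R) :
    ∃ v : ℝ, 0 ≤ v ∧ partialGap (lagrangian f r Lc Mc) (Metric.closedBall 0 R)
      (Metric.closedBall 0 R) a s = v := by
  obtain ⟨hxs, hss, hsv⟩ := (isSaddle_lagrangian_iff hfr ⟨s, hs⟩).1 hsad
  have hlow := le_partialGap hfr (BX := Metric.closedBall 0 R) (BS := Metric.closedBall 0 R) ha hs
    (by simpa using hxR) hxs (by simpa using hsR) hss
  obtain ⟨x₀, v₀, hv₀⟩ := hfr.exists_liftedReg_eq_coe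
  obtain ⟨u₀, -, hu₀⟩ := (isCompact_closedBall (0 : Lifted m d) R).exists_isMinOn
    ⟨xs, by simpa using hxR⟩ hfr.continuous_sumLoss.continuousOn
  -- The loss is bounded below on the ball by compactness, and the conjugate by its affine minorant
  -- at `x₀`; the inner products are bounded by Cauchy-Schwarz.
  have hup : partialGap (lagrangian f r Lc Mc) (Metric.closedBall 0 R) (Metric.closedBall 0 R) a s ≤
      ((sumLoss f a.fst + R * ‖a‖ + R * ‖x₀‖ + v₀ - sumLoss f u₀.fst + ‖s‖ * R
        + conjVal (liftedReg r) s : ℝ) : EReal) := by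
    refine partialGap_le hfr ha hs fun u huB hu p hpB hp => ?_
    have h1 := inner_sub_le_conjVal hv₀ hp
    have h2 : sumLoss f u₀.fst ≤ sumLoss f u.fst := hu₀ huB
    rw [mem_closedBall_zero_iff] at huB hpB
    have h3 : inner ℝ p a ≤ R * ‖a‖ := (real_inner_le_norm p a).trans (by gcongr)
    have h4 : -(R * ‖x₀‖) ≤ inner ℝ p x₀ :=
      neg_le_of_abs_le ((abs_real_inner_le_norm p x₀).trans (by gcongr))
    have h5 : -(‖s‖ * R) ≤ inner ℝ s u :=
      neg_le_of_abs_le ((abs_real_inner_le_norm s u).trans (by gcongr))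
    unfold saddleValue
    linarith
  have hv := EReal.coe_toReal (ne_top_of_le_ne_top (EReal.coe_ne_top _) hup)
    (ne_bot_of_le_ne_bot (EReal.coe_ne_bot _) hlow)
  refine ⟨_, ?_, hv.symm⟩
  rw [← hv, EReal.coe_le_coe_iff] at hlow
  exact le_trans (sub_nonneg.2 (hsv a ha s hs)) hlow

end Lagrangian

/-! ### Stepsizes and the tail of the iteration -/

section Tail

variable {m d : ℕ} {G : SimpleGraph (Fin m)} {W Lc Mc : Matrix (Fin m) (Fin m) ℝ}
  {f : Fin m → EuclideanSpace ℝ (Fin d) → ℝ} {r : Fin m → EuclideanSpace ℝ (Fin d) → EReal}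
  {η δ : ℝ} {slack : ℕ → ℝ} {α : ℕ → Fin m → ℝ} {X A S D : ℕ → Stack m d}

theorem minStep_le (a : Fin m → ℝ) (i : Fin m) : minStep a ≤ a i :=
  ciInf_le (Set.finite_range a).bddBelow i

theorem exists_eq_minStep [Nonempty (Fin m)] (a : Fin m → ℝ) : ∃ i, a i = minStep a :=
  exists_eq_ciInf_of_finite

theorem IsLocalDATOS.minStep_zero_pos [Nonempty (Fin m)]
    (h : IsLocalDATOS G W f r η δ slack α X A S D) : 0 < minStep (α 0) := by
  obtain ⟨i, hi⟩ := exists_eq_minStep (α 0)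
  exact hi ▸ h.init_step i

/-- After a proximal step, the primal iterate is a subgradient of the conjugate at the dual one. -/
theorem IsLocalDATOS.conj_subgradient (h : IsLocalDATOS G W f r η δ slack α X A S D)
    (hfr : ObjectiveAssumptions f r) {k : ℕ} (hpos : ∀ i, 0 < α (k + 1) i) :
    liftedS f Lc Mc α X S D (k + 1) ∈ conjDom (liftedReg r) ∧
      ∀ p ∈ conjDom (liftedReg r), conjVal (liftedReg r) (liftedS f Lc Mc α X S D (k + 1)) +
        inner ℝ (liftedX X (k + 1)) (p - liftedS f Lc Mc α X S D (k + 1)) ≤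
          conjVal (liftedReg r) p := by
  choose b hb hsub using fun i =>
    (h.update_X k i).subgradient (hpos i) (hfr.r_convex_proper_lsc i)
  refine conjVal_subgradient (liftedReg_ne_bot hfr.r_ne_bot)
    (liftedReg_eq_coe (x := liftedX X (k + 1)) rfl hb) fun y v hv => ?_
  obtain ⟨hy, w, hw, rfl⟩ := liftedReg_coe_iff hfr.r_ne_bot hv
  have hin : inner ℝ (liftedS f Lc Mc α X S D (k + 1)) (y - liftedX X (k + 1)) =
      ∑ i, inner ℝ (S (k + 1) i) (y.fst i - X (k + 1) i) := by
    rw [WithLp.prod_inner_apply]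
    change inner ℝ (S (k + 1)) (y.fst - X (k + 1)) +
      inner ℝ (-rowMix Mc (dualY f Lc α X S D (k + 1))) (y.snd - 0) = _
    rw [hy, sub_zero, inner_zero_right, add_zero, PiLp.inner_apply]
    rfl
  rw [hin, ← Finset.sum_add_distrib]
  refine Finset.sum_le_sum fun i _ => ?_
  -- The dual update is chosen so that the subgradient produced by the proximal step is exactly the
  -- new dual row.
  have e : (α (k + 1) i)⁻¹ • (A (k + 1) i + α (k + 1) i • S k i - X (k + 1) i) = S (k + 1) i := by
    have h1 : S (k + 1) i = S k i + (α (k + 1) i)⁻¹ • (A (k + 1) i - X (k + 1) i) := by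
      rw [h.update_S k]
      rfl
    rw [h1, add_sub_right_comm, smul_add, inv_smul_smul₀ (hpos i).ne', add_comm]
  have := hsub i (y.fst i) (w i) (hw i).le
  rwa [e] at this

theorem IsLocalDATOS.minStep_pos [Nonempty (Fin m)]
    (h : IsLocalDATOS G W f r η δ slack α X A S D) {b : ℝ} (hb : 0 < b)
    (hα : ∀ k, b ≤ minStep (α (k + 1))) (k : ℕ) : 0 < minStep (α k) := by
  cases k with
  | zero => exact h.minStep_zero_pos
  | succ k => exact hb.trans_le (hα k)

/-- The iterates with local min-consensus eventually form a splitting scheme with a common,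
nondecreasing stepsize. -/
theorem IsLocalDATOS.exists_tail (h : IsLocalDATOS G W f r η δ slack α X A S D)
    (hfr : ObjectiveAssumptions f r) (hG : G.Connected) (hLM : IsBCVPair W Lc Mc)
    (hη : η ∈ Set.Ioo (0 : ℝ) 1) (hδ : 0 < δ) (hslack : ∀ k, 0 ≤ slack k)
    (hsum : Summable slack) {b : ℝ} (hb : 0 < b) (hα : ∀ k, b ≤ minStep (α (k + 1))) :
    ∃ N, 1 ≤ N ∧ (∀ k, N ≤ k → ∀ i, α k i = minStep (α k)) ∧
      IsSplittingTail (fun x : Lifted m d => sumLoss f x.fst) (conjVal (liftedReg r))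
        (consSet Lc Mc) (conjDom (liftedReg r)) δ N (fun k => minStep (α k)) (liftedX X)
        (liftedA Lc Mc A) (liftedS f Lc Mc α X S D) := by
  have : Nonempty (Fin m) := hG.nonempty
  have hpos : ∀ k i, 0 < α k i := fun k i => (h.minStep_pos hb hα k).trans_le (minStep_le _ i)
  -- Index `0` holds the initial stepsizes, which `b` does not bound; hence the minimum of two lower
  -- bounds.
  obtain ⟨N, hN⟩ := eventually_consensus hG hη (lt_min hb h.minStep_zero_pos) hslack hsum
    (α := α) (fun k i => by
      refine le_trans ?_ (minStep_le (α k) i)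
      cases k with
      | zero => exact min_le_right _ _
      | succ k => exact (min_le_left _ _).trans (hα k))
    (Acc := fun k i a => LinesearchAccepts (f i) (X k i) (rowMix W (X k) i)
      (-(halfD f W (X k) (S k) (D k) i)) δ a)
    (fun k => by
      obtain ⟨β, hβ, hmin⟩ := h.step k
      exact ⟨β, fun i => (hβ i).elim fun t ht => ⟨t, ht.1, ht.2.1⟩, hmin⟩)
  have huni : ∀ k, N ≤ k → ∀ i, α k i = minStep (α k) := fun k hk i => by
    obtain ⟨j, hj⟩ := exists_eq_minStep (α k)
    rw [← hj]
    exact (hN k hk).1 i j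
  have hsq : ∀ k, N ≤ k → minStep (α (k + 1)) ^ 2 = minStep (α k) ^ 2 + slack k := fun k hk => by
    obtain ⟨j, hj⟩ := exists_eq_minStep (α k)
    rw [← hj, ← huni (k + 1) (by omega) j]
    exact (hN k hk).2.1 j
  have hsub : ∀ k, 1 ≤ k → liftedS f Lc Mc α X S D k ∈ conjDom (liftedReg r) ∧
      ∀ p ∈ conjDom (liftedReg r), conjVal (liftedReg r) (liftedS f Lc Mc α X S D k) +
        inner ℝ (liftedX X k) (p - liftedS f Lc Mc α X S D k) ≤ conjVal (liftedReg r) p := by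
    intro k hk
    obtain ⟨k, rfl⟩ := Nat.exists_eq_add_of_le' hk
    exact h.conj_subgradient hfr (hpos (k + 1))
  have hσpos := h.minStep_pos hb hα
  -- Starting at `N + 1 ≥ 1` avoids the arbitrary initial dual point, which may lie outside the
  -- domain of the conjugate.
  refine ⟨N + 1, by omega, fun k hk => huni k (by omega), ?_⟩
  constructor
  · exact fun k _ => hσpos k
  · intro k hk
    refine (pow_le_pow_iff_left₀ (hσpos k).le (hσpos (k + 1)).le two_ne_zero).1 ?_
    rw [hsq k (by omega)]
    exact le_add_of_nonneg_right (hslack k)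
  · refine ⟨Real.sqrt (minStep (α N) ^ 2 + ∑' k, slack k), fun k hk => ?_⟩
    have hacc : ∀ k, N ≤ k →
        minStep (α k) ^ 2 ≤ minStep (α N) ^ 2 + ∑ t ∈ Finset.range k, slack t := by
      intro k hk
      induction k, hk using Nat.le_induction with
      | base => exact le_add_of_nonneg_right (Finset.sum_nonneg fun i _ => hslack i)
      | succ k hk ih =>
        rw [hsq k hk, Finset.sum_range_succ]
        linarith
    refine Real.le_sqrt_of_sq_le ((hacc k (by omega)).trans ?_)
    gcongr
    exact hsum.sum_le_tsum _ fun i _ => hslack i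
  · exact fun k _ => hLM.liftedA_mem A (k + 1)
  · exact fun k _ => (hsub (k + 1) (by omega)).1
  · exact fun k hk => h.lifted_dual_update hLM (huni (k + 1) (by omega)) (hσpos (k + 1)).ne'
  -- Adding the subgradient inequalities at two consecutive dual iterates gives monotonicity.
  · intro k hk
    have h1 := (hsub k (by omega)).2 _ (hsub (k + 1) (by omega)).1
    have h2 := (hsub (k + 1) (by omega)).2 _ (hsub k (by omega)).1
    rw [← neg_sub (liftedS f Lc Mc α X S D (k + 1)), inner_neg_right] at h2
    rw [real_inner_comm, inner_sub_left]
    linarith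
  · intro k hk u hu p hp
    have hτ := huni (k + 1) (by omega)
    refine splitting_energy (hσpos (k + 1)) (g := block (gradLoss f (X k)) 0) ?_ ?_ ?_
      ((hsub (k + 1) (by omega)).2 p hp)
      (h.lifted_dual_update hLM hτ (hσpos (k + 1)).ne')
    · have h1 := h.descent hτ fun i => hτ i ▸ (hN k (by omega)).2.2 i
      have h2 : inner ℝ (block (gradLoss f (X k)) 0) (liftedA Lc Mc A (k + 1) - liftedX X k) =
          inner ℝ (gradLoss f (X k)) (A (k + 1) - X k) := by
        rw [WithLp.prod_inner_apply]
        change inner ℝ (gradLoss f (X k)) (A (k + 1) - X k) + inner ℝ 0 _ = _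
        rw [inner_zero_left, add_zero]
      -- The lower block enters only the quadratic term, which it can only enlarge.
      have h3 : ‖A (k + 1) - X k‖ ^ 2 ≤ ‖liftedA Lc Mc A (k + 1) - liftedX X k‖ ^ 2 := by
        rw [lifted_norm_sq]
        exact le_add_of_nonneg_right (sq_nonneg _)
      rw [h2]
      refine h1.trans ?_
      have h4 : 0 ≤ δ / (2 * minStep (α (k + 1))) :=
        div_nonneg hδ.le (mul_nonneg zero_le_two (hσpos (k + 1)).le)
      exact add_le_add_right (mul_le_mul_of_nonneg_left h3 h4) _
    · have h2 : inner ℝ (block (gradLoss f (X k)) 0) (u - liftedX X k) =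
          inner ℝ (gradLoss f (X k)) (u.fst - X k) := by
        rw [WithLp.prod_inner_apply]
        change inner ℝ (gradLoss f (X k)) (u.fst - X k) + inner ℝ 0 _ = _
        rw [inner_zero_left, add_zero]
      rw [h2]
      exact hfr.add_inner_gradLoss_le (X k) u.fst
    · exact h.lifted_projection hLM hτ (consSet_sub (hLM.liftedA_mem A (k + 1)) hu)

/-- Jensen's inequality for ergodic averages. -/
theorem saddleValue_ergodic_le (hfr : ObjectiveAssumptions f r) {K k : ℕ}
    (hσ : ∀ t, 0 < minStep (α t)) (hKk : K ≤ k) {a s : ℕ → Lifted m d}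
    (hs : ∀ t, K ≤ t → s t ∈ conjDom (liftedReg r)) (u p : Lifted m d) :
    ergodic α K s k ∈ conjDom (liftedReg r) ∧
    saddleValue (fun x => sumLoss f x.fst) (conjVal (liftedReg r)) (ergodic α K a k) p -
        saddleValue (fun x => sumLoss f x.fst) (conjVal (liftedReg r)) u (ergodic α K s k) ≤
      (∑ t ∈ Finset.Icc K k, minStep (α t))⁻¹ * ∑ t ∈ Finset.Icc K k, minStep (α t) *
        (saddleValue (fun x => sumLoss f x.fst) (conjVal (liftedReg r)) (a t) p -
          saddleValue (fun x => sumLoss f x.fst) (conjVal (liftedReg r)) u (s t)) := by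
  set θ := ∑ t ∈ Finset.Icc K k, minStep (α t) with hθ
  have hθp : 0 < θ := Finset.sum_pos (fun t _ => hσ t) ⟨K, Finset.mem_Icc.2 ⟨le_rfl, hKk⟩⟩
  have herg : ∀ z : ℕ → Lifted m d,
      ergodic α K z k = ∑ t ∈ Finset.Icc K k, (θ⁻¹ * minStep (α t)) • z t := fun z => by
    simp only [ergodic, Finset.smul_sum, smul_smul, hθ]
  have hw : ∀ t ∈ Finset.Icc K k, 0 ≤ θ⁻¹ * minStep (α t) := fun t _ =>
    mul_nonneg (inv_nonneg.2 hθp.le) (hσ t).le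
  have hw1 : ∑ t ∈ Finset.Icc K k, θ⁻¹ * minStep (α t) = 1 := by
    rw [← Finset.mul_sum, ← hθ, inv_mul_cancel₀ hθp.ne']
  obtain ⟨hmem, hρ⟩ := conjVal_sum_le (liftedReg_ne_bot hfr.r_ne_bot)
    hfr.exists_liftedReg_eq_coe hw hw1 (p := s) fun t ht => hs t (Finset.mem_Icc.1 ht).1
  have hΦ := hfr.convexOn_sumLoss.map_sum_le hw hw1 (p := a) fun t _ => Set.mem_univ _
  rw [herg a, herg s]
  refine ⟨hmem, ?_⟩
  have e : θ⁻¹ * ∑ t ∈ Finset.Icc K k, minStep (α t) *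
      (saddleValue (fun x => sumLoss f x.fst) (conjVal (liftedReg r)) (a t) p -
        saddleValue (fun x => sumLoss f x.fst) (conjVal (liftedReg r)) u (s t)) =
      ∑ t ∈ Finset.Icc K k, (θ⁻¹ * minStep (α t)) • sumLoss f (a t).fst
        + inner ℝ p (∑ t ∈ Finset.Icc K k, (θ⁻¹ * minStep (α t)) • a t)
        - conjVal (liftedReg r) p - sumLoss f u.fst
        - inner ℝ (∑ t ∈ Finset.Icc K k, (θ⁻¹ * minStep (α t)) • s t) u
        + ∑ t ∈ Finset.Icc K k, θ⁻¹ * minStep (α t) * conjVal (liftedReg r) (s t) := by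
    have hc : ∀ c : ℝ, c = ∑ t ∈ Finset.Icc K k, θ⁻¹ * minStep (α t) * c := fun c => by
      rw [← Finset.sum_mul, hw1, one_mul]
    rw [hc (conjVal (liftedReg r) p), hc (sumLoss f u.fst), inner_sum, sum_inner, Finset.mul_sum]
    simp only [real_inner_smul_left, real_inner_smul_right, ← Finset.sum_add_distrib,
      ← Finset.sum_sub_distrib]
    refine Finset.sum_congr rfl fun t _ => ?_
    simp only [saddleValue, smul_eq_mul]
    ring
  rw [e]
  simp only [saddleValue]
  linarith

end Tail

/-! ### Choice of the start index and the ergodic rate -/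

section Rate

variable {m d : ℕ} {G : SimpleGraph (Fin m)} {W Lc Mc : Matrix (Fin m) (Fin m) ℝ}
  {f : Fin m → EuclideanSpace ℝ (Fin d) → ℝ} {r : Fin m → EuclideanSpace ℝ (Fin d) → EReal}
  {δ : ℝ} {α : ℕ → Fin m → ℝ}

/-- The partial gap of ergodic averages is controlled by the partial gaps of the first iterates once
the averages start late enough. If one of the latter is positive, the summed energy inequality can be
made small against it; otherwise Jensen's inequality applies. -/
theorem exists_start_index (hfr : ObjectiveAssumptions f r) {N : ℕ} {x a s : ℕ → Lifted m d}
    (h : IsSplittingTail (fun x : Lifted m d => sumLoss f x.fst) (conjVal (liftedReg r))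
      (consSet Lc Mc) (conjDom (liftedReg r)) δ N (fun k => minStep (α k)) x a s)
    (hδ : δ < 1) (hσ : ∀ t, 0 < minStep (α t)) {b : ℝ} (hb : 0 < b)
    (hα : ∀ k, b ≤ minStep (α (k + 1))) {u₀ p₀ : Lifted m d} (hx : Tendsto x atTop (𝓝 u₀))
    (hs : Tendsto s atTop (𝓝 p₀)) (hmem : ∀ t, a t ∈ consSet Lc Mc)
    (hdom : ∀ t, 1 ≤ t → s t ∈ conjDom (liftedReg r)) {R : ℝ} {gap : ℕ → ℝ}
    (hgap : ∀ t, 1 ≤ t → 0 ≤ gap t) (hgap_eq : ∀ t, 1 ≤ t → partialGap (lagrangian f r Lc Mc)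
      (Metric.closedBall 0 R) (Metric.closedBall 0 R) (a t) (s t) = gap t) :
    ∃ K, N + 1 ≤ K ∧ ∀ k, K < k → partialGap (lagrangian f r Lc Mc)
      (Metric.closedBall 0 R) (Metric.closedBall 0 R) (ergodic α K a k) (ergodic α K s k) ≤
        ((1 / ((k : ℝ) - K) * ((2 * ∑ t ∈ Finset.Icc 1 K, minStep (α t) * gap t) /
          (2 * minStep (α 0))) : ℝ) : EReal) := by
  have herg_mem : ∀ K k, ergodic α K a k ∈ consSet Lc Mc := fun K k =>
    consSet_smul _ (consSet_sum _ _ fun t _ => hmem t)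
  have hterm : ∀ t, 1 ≤ t → 0 ≤ minStep (α t) * gap t := fun t ht =>
    mul_nonneg (hσ t).le (hgap t ht)
  by_cases hz : ∃ t₀, 1 ≤ t₀ ∧ 0 < gap t₀
  · obtain ⟨t₀, ht₀, hpos⟩ := hz
    set c₀ := 2 * (minStep (α t₀) * gap t₀) with hc₀
    have hc₀p : 0 < c₀ := by have := hσ t₀; positivity
    have hσ0 := hσ 0
    -- The average has total weight at least `(k - K) b`, so this tolerance bounds its gap by `c₀ /
    -- (2 (k - K) minStep (α 0))`; and `c₀` is one of the nonnegative terms of the constant.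
    obtain ⟨J, hNJ, hJ⟩ := h.sum_energy_le hδ hx hs R (ε := b * c₀ / minStep (α 0)) (by positivity)
    refine ⟨max J t₀ + 1, by omega, fun k hk => ?_⟩
    set K := max J t₀ + 1 with hK
    have hK1 : 1 ≤ K := by omega
    have hkK : (0 : ℝ) < (k : ℝ) - K := sub_pos.2 (Nat.cast_lt.2 hk)
    set θ := ∑ t ∈ Finset.Icc K k, minStep (α t) with hθ
    have hθle : ((k : ℝ) - K) * b ≤ θ := by
      have h1 : ∑ _t ∈ Finset.Icc K k, b ≤ θ := Finset.sum_le_sum fun t ht => by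
        obtain ⟨t, rfl⟩ := Nat.exists_eq_add_of_le' (hK1.trans (Finset.mem_Icc.1 ht).1)
        exact hα t
      rw [Finset.sum_const, Nat.card_Icc, nsmul_eq_mul, Nat.cast_sub (by omega)] at h1
      push_cast at h1
      nlinarith
    have hθp : 0 < θ := lt_of_lt_of_le (by positivity) hθle
    have hC : c₀ ≤ 2 * ∑ t ∈ Finset.Icc 1 K, minStep (α t) * gap t := by
      have := Finset.single_le_sum (f := fun t => minStep (α t) * gap t)
        (fun t ht => hterm t (Finset.mem_Icc.1 ht).1) (Finset.mem_Icc.2 ⟨ht₀, by omega⟩ :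
          t₀ ∈ Finset.Icc 1 K)
      simp only [hc₀]
      linarith
    have hsK : ∀ t, K ≤ t → s t ∈ conjDom (liftedReg r) := fun t ht => hdom t (hK1.trans ht)
    refine partialGap_le hfr (herg_mem K k)
      (saddleValue_ergodic_le hfr hσ hk.le hsK (a := a) 0 0).1 fun u huB hu p hpB hp => ?_
    rw [mem_closedBall_zero_iff] at huB hpB
    refine (saddleValue_ergodic_le hfr hσ hk.le hsK u p).2.trans ?_
    have hE := hJ (max J t₀) (le_max_left _ _) k (by omega) u hu p hp huB hpB
    simp only [mul_assoc, ← Finset.mul_sum] at hE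
    have hC0 : 0 ≤ 2 * ∑ t ∈ Finset.Icc 1 K, minStep (α t) * gap t := hc₀p.le.trans hC
    rw [← hθ, inv_mul_eq_div, div_le_iff₀ hθp]
    calc _ ≤ b * c₀ / minStep (α 0) / 2 := by rw [le_div_iff₀ two_pos]; linarith
      _ = 1 / ((k : ℝ) - K) * (c₀ / (2 * minStep (α 0))) * (((k : ℝ) - K) * b) := by
          field_simp
      _ ≤ _ := by gcongr
  · push Not at hz
    refine ⟨N + 1, le_rfl, fun k hk => ?_⟩
    set K := N + 1 with hK
    have hkK : (0 : ℝ) < (k : ℝ) - K := sub_pos.2 (Nat.cast_lt.2 hk)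
    have hsK : ∀ t, K ≤ t → s t ∈ conjDom (liftedReg r) := fun t ht => hdom t (by omega)
    refine partialGap_le hfr (herg_mem K k)
      (saddleValue_ergodic_le hfr hσ hk.le hsK (a := a) 0 0).1 fun u huB hu p hpB hp => ?_
    refine (saddleValue_ergodic_le hfr hσ hk.le hsK u p).2.trans (le_trans (b := 0) ?_ ?_)
    · refine mul_nonpos_of_nonneg_of_nonpos
        (inv_nonneg.2 (Finset.sum_nonneg fun t _ => (hσ t).le)) (Finset.sum_nonpos fun t ht => ?_)
      have ht1 : 1 ≤ t := by have := (Finset.mem_Icc.1 ht).1; omega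
      have hle := le_partialGap hfr (hmem t) (hdom t ht1) huB hu hpB hp
      rw [hgap_eq t ht1, EReal.coe_le_coe_iff] at hle
      exact mul_nonpos_of_nonneg_of_nonpos (hσ t).le (hle.trans (hz t ht1))
    · have h1 : 0 ≤ ∑ t ∈ Finset.Icc 1 K, minStep (α t) * gap t :=
        Finset.sum_nonneg fun t ht => hterm t (Finset.mem_Icc.1 ht).1
      have := hσ 0
      positivity

end Rate

/-! ### The main theorem -/

theorem theorem4p3 {m d : ℕ}
    (f : Fin m → EuclideanSpace ℝ (Fin d) → ℝ) (r : Fin m → EuclideanSpace ℝ (Fin d) → EReal)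
    (hfr : ObjectiveAssumptions f r)
    (G : SimpleGraph (Fin m)) (hG : G.Connected)
    (W₀ : Matrix (Fin m) (Fin m) ℝ) (hW₀ : IsGossip G W₀)
    (c : ℝ) (hc : c ∈ Set.Ioo (0 : ℝ) (1 / 2))
    (W : Matrix (Fin m) (Fin m) ℝ) (hW : W = (1 - c) • (1 : Matrix (Fin m) (Fin m) ℝ) + c • W₀)
    (Lc Mc : Matrix (Fin m) (Fin m) ℝ) (hLM : IsBCVPair W Lc Mc)
    (hsaddle : ∃ xs ss, IsSaddle (lagrangian f r Lc Mc) xs ss)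
    (η δ : ℝ) (hη : η ∈ Set.Ioo (0 : ℝ) 1) (hδ : δ ∈ Set.Ioo (0 : ℝ) 1)
    (slack : ℕ → ℝ) (hslack : ∀ k, 0 ≤ slack k) (hslack_sum : Summable slack)
    (α : ℕ → Fin m → ℝ) (X A S D : ℕ → Stack m d)
    (hrun : IsLocalDATOS G W f r η δ slack α X A S D)
    (αlow : ℝ) (hαlow : 0 < αlow) (hα : ∀ k, αlow ≤ minStep (α (k + 1))) :
    (∃ xs ss, IsSaddle (lagrangian f r Lc Mc) xs ss ∧
      Tendsto (liftedX X) atTop (𝓝 xs) ∧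
      Tendsto (liftedS f Lc Mc α X S D) atTop (𝓝 ss)) ∧
    ∀ xs ss, IsSaddle (lagrangian f r Lc Mc) xs ss →
      ∃ (BX BS : Set (Lifted m d)) (K : ℕ), IsCompact BX ∧ IsCompact BS ∧ 1 ≤ K ∧
        (∀ k, K ≤ k → ∀ i, α (k + 1) i = minStep (α (k + 1))) ∧
        (xs, ss) ∈ BX ×ˢ BS ∧
        (∀ k, K ≤ k →
          (liftedA Lc Mc A k, liftedS f Lc Mc α X S D k) ∈ interior (BX ×ˢ BS)) ∧
        ∃ C : ℝ,
          (C : EReal) = 2 * ∑ t ∈ Finset.Icc 1 K, (minStep (α t) : EReal) *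
            partialGap (lagrangian f r Lc Mc) BX BS
              (liftedA Lc Mc A t) (liftedS f Lc Mc α X S D t) ∧
          ∀ k, K < k → ∀ L : ℝ≥0, 0 < L →
            LipschitzOnWith L (gradLoss f) (trajectoryHull X A k) →
            partialGap (lagrangian f r Lc Mc) BX BS
                (ergodic α K (liftedA Lc Mc A) k) (ergodic α K (liftedS f Lc Mc α X S D) k) ≤
              ((1 / ((k : ℝ) - (K : ℝ)) *
                ((C + (1 + minStep (α K) * Real.sqrt (20 / αlow ^ 2 + 3)) ^ 2 *
                    merit α (liftedX X) (liftedS f Lc Mc α X S D) xs ss K) /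
                  (2 * min (minStep (α 0)) (δ / (2 * (L : ℝ))))) : ℝ) : EReal) := by
  have : Nonempty (Fin m) := hG.nonempty
  have hσ := hrun.minStep_pos hαlow hα
  obtain ⟨N, hN1, huni, htail⟩ :=
    hrun.exists_tail hfr hG hLM hη hδ.1 hslack hslack_sum hαlow hα
  have hdom : ∀ t, 1 ≤ t → liftedS f Lc Mc α X S D t ∈ conjDom (liftedReg r) := fun t ht => by
    obtain ⟨t, rfl⟩ := Nat.exists_eq_add_of_le' ht
    exact (hrun.conj_subgradient hfr fun i => (hσ (t + 1)).trans_le (minStep_le _ i)).1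
  have hiff : ∀ {xs ss}, _ := fun {xs ss} =>
    isSaddle_lagrangian_iff (Lc := Lc) (Mc := Mc) hfr ⟨_, hdom 1 le_rfl⟩ (xs := xs) (ss := ss)
  obtain ⟨u₀, hu₀, p₀, hp₀, hsv, hx, ha, hs⟩ := htail.exists_tendsto_saddle hδ.2
    hfr.continuous_sumLoss (isClosed_consSet Lc Mc)
    (fun _ _ _ _ h1 h2 h3 h4 => conjVal_lsc (liftedReg_ne_bot hfr.r_ne_bot)
      hfr.exists_liftedReg_eq_coe h1 h2 h3 h4)
    (by
      obtain ⟨xs, ss, h⟩ := hsaddle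
      obtain ⟨h1, h2, h3⟩ := hiff.1 h
      exact ⟨xs, h1, ss, h2, h3⟩)
  refine ⟨⟨u₀, p₀, hiff.2 ⟨hu₀, hp₀, hsv⟩, hx, hs⟩, fun xs ss hsad => ?_⟩
  obtain ⟨ba, hba⟩ := ha.norm.bddAbove_range
  obtain ⟨bs, hbs⟩ := hs.norm.bddAbove_range
  -- The summand `1` puts all iterates strictly inside the ball.
  obtain ⟨R, hR⟩ : ∃ R, R = max (max ba bs) (max ‖xs‖ ‖ss‖) + 1 := ⟨_, rfl⟩
  have hxsR : ‖xs‖ ≤ R := by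
    linarith [le_max_left ‖xs‖ ‖ss‖, le_max_right (max ba bs) (max ‖xs‖ ‖ss‖)]
  have hssR : ‖ss‖ ≤ R := by
    linarith [le_max_right ‖xs‖ ‖ss‖, le_max_right (max ba bs) (max ‖xs‖ ‖ss‖)]
  have haR : ∀ k, ‖liftedA Lc Mc A k‖ < R := fun k => by
    have h1 : ‖liftedA Lc Mc A k‖ ≤ ba := hba ⟨k, rfl⟩
    linarith [le_max_left ba bs, le_max_left (max ba bs) (max ‖xs‖ ‖ss‖)]
  have hsR : ∀ k, ‖liftedS f Lc Mc α X S D k‖ < R := fun k => by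
    have h1 : ‖liftedS f Lc Mc α X S D k‖ ≤ bs := hbs ⟨k, rfl⟩
    linarith [le_max_right ba bs, le_max_left (max ba bs) (max ‖xs‖ ‖ss‖)]
  -- At `t = 0` the gap may fail to be real, so a dummy value is taken; the constant sums from `1`.
  have hex : ∀ t, ∃ v : ℝ, 1 ≤ t → 0 ≤ v ∧ partialGap (lagrangian f r Lc Mc)
      (Metric.closedBall 0 R) (Metric.closedBall 0 R) (liftedA Lc Mc A t)
      (liftedS f Lc Mc α X S D t) = v := fun t => by
    by_cases ht : 1 ≤ t
    · obtain ⟨v, hv⟩ :=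
        exists_partialGap_eq_coe hfr (hLM.liftedA_mem A t) (hdom t ht) hsad hxsR hssR
      exact ⟨v, fun _ => hv⟩
    · exact ⟨0, fun h => absurd h ht⟩
  choose gap hgap using hex
  obtain ⟨K, hNK, hrate⟩ := exists_start_index hfr htail hδ.2 hσ hαlow hα hx hs
    (hLM.liftedA_mem A) hdom (fun t ht => (hgap t ht).1) fun t ht => (hgap t ht).2
  refine ⟨Metric.closedBall 0 R, Metric.closedBall 0 R, K, isCompact_closedBall _ _,
    isCompact_closedBall _ _, by omega, fun k hk => huni (k + 1) (by omega),
    ⟨by simpa using hxsR, by simpa using hssR⟩, fun k _ => ?_,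
    2 * ∑ t ∈ Finset.Icc 1 K, minStep (α t) * gap t, ?_, fun k hk L hL _ => ?_⟩
  · rw [interior_prod_eq]
    exact ⟨Metric.ball_subset_interior_closedBall (by simpa using haR k),
      Metric.ball_subset_interior_closedBall (by simpa using hsR k)⟩
  · rw [EReal.coe_mul, ereal_coe_sum]
    refine congrArg₂ _ rfl (Finset.sum_congr rfl fun t ht => ?_)
    rw [(hgap t (Finset.mem_Icc.1 ht).1).2, EReal.coe_mul]
  -- The stated bound is weaker than `hrate`: the merit term is nonnegative and the minimum is at
  -- most the initial stepsize.
  · refine (hrate k hk).trans (EReal.coe_le_coe_iff.2 ?_)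
    have hkK : (0 : ℝ) < (k : ℝ) - K := sub_pos.2 (Nat.cast_lt.2 hk)
    have hC : 0 ≤ 2 * ∑ t ∈ Finset.Icc 1 K, minStep (α t) * gap t :=
      mul_nonneg zero_le_two <| Finset.sum_nonneg fun t ht =>
        mul_nonneg (hσ t).le (hgap t (Finset.mem_Icc.1 ht).1).1
    have hV : 0 ≤ (1 + minStep (α K) * Real.sqrt (20 / αlow ^ 2 + 3)) ^ 2 *
        merit α (liftedX X) (liftedS f Lc Mc α X S D) xs ss K := by
      unfold merit
      positivity
    have hmin : 0 < min (minStep (α 0)) (δ / (2 * (L : ℝ))) :=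
      lt_min (hσ 0) (div_pos hδ.1 (mul_pos two_pos (NNReal.coe_pos.2 hL)))
    gcongr
    · linarith
    · exact min_le_left _ _
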